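/- Let $\mathbb K=\mathbb R$ or $\mathbb C$, let $\mathfrak g$ be a finite-dimensional Lie algebra over $\mathbb K$, write $\mathrm{ad}^*_x$ for the transpose of $\mathrm{ad}_x$, so that $\langle \mathrm{ad}^*_x\xi,y\rangle=\langle\xi,[x,y]\rangle$, and let $\mathcal G=(\mathfrak g,[\,,\,],0,\varphi)$ be a cocommutative Lie quasi-bialgebra. That is, $\varphi\in\wedge^3\mathfrak g$ and $\mathfrak d=\mathfrak g\oplus\mathfrak g^*$ (the canonical double of $\mathcal G$) is a Lie algebra for the bracket $$[x,y]_{\mathfrak d}=[x,y],\qquad [x,\xi]_{\mathfrak d}=-\mathrm{ad}^*_x\xi,\qquad [\xi,\eta]_{\mathfrak d}=\langle\xi\otimes\eta\otimes 1,\varphi\rangle\in\mathfrak g\qquad(x,y\in\mathfrak g,\ \xi,\eta\in\mathfrak g^*).$$ Let $F(z)=\coth z-\frac1z$ (with $F(0)=0$), and let $$U=\{p\in\mathfrak g^* : \mathrm{Spec}_{\mathfrak d}(\mathrm{ad}^{\mathfrak d}_p)\cap i\pi\mathbb Z^*=\emptyset\},$$ where $\mathrm{Spec}$ is the set of complex eigenvalues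 and $\mathbb Z^*=\mathbb Z\setminus\{0\}$. Then: 1. $U$ is an open subset of $\mathfrak g^*$ containing $0$, and it is invariant under the coadjoint action of a connected Lie group $G$ with Lie algebra $\mathfrak g$, i.e. under all maps $p\mapsto p\circ e^{\mathrm{ad}_z}$, $z\in\mathfrak g$. 2. For $p\in U$ the endomorphism $F(\mathrm{ad}^{\mathfrak d}_p)$ of $\mathfrak d$ is defined (by the holomorphic functional calculus) and maps $\mathfrak g^*$ to $\mathfrak g$. Let $r^{AM}_p\colon\mathfrak g^*\to\mathfrak g$ be its restriction. 3. $r^{AM}$ is a dynamical $r$-matrix over $U$ associated with $\mathcal G$: each $r^{AM}_p$ is skew-symmetric, $p\mapsto r^{AM}_p$ is smooth on $U$, and for all $p\in U$, $z\in\mathfrak g$, $\xi,\eta,\zeta\in\mathfrak g^*$, writing $r=r^{AM}$, $$\sum_{\mathrm{cycl}(\xi,\eta,\zeta)}\Big(\langle\zeta,d_pr(\xi)\eta\rangle-\langle\zeta,[r_p\xi,r_p\eta]\rangle\Big)=\langle\xi\otimes\eta\otimes\zeta,\varphi\rangle,\qquad d_pr(\mathrm{ad}^*_zp)+\mathrm{ad}_z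 r_p+r_p\,\mathrm{ad}^*_z=0.$$ 4. $r^{AM}$ depends only on the associator: two cocommutative Lie quasi-bialgebra structures on the Lie algebra $\mathfrak g$ with the same $\varphi$ have the same $U$ and the same $r^{AM}$. Moreover, if $\Omega\colon\mathfrak g^*\to\mathfrak g$ is any linear map that is symmetric and $\mathfrak g$-invariant ($\mathrm{ad}_x\Omega+\Omega\,\mathrm{ad}^*_x=0$ for all $x\in\mathfrak g$) and satisfies $\langle\xi\otimes\eta\otimes\zeta,\varphi\rangle=\langle\zeta,[\Omega\xi,\Omega\eta]\rangle$ for all $\xi,\eta,\zeta\in\mathfrak g^*$, then for every $p\in U$ the endomorphism $F(\mathrm{ad}_{\Omega p})$ of $\mathfrak g$ is defined and $r^{AM}_p=F(\mathrm{ad}_{\Omega p})\circ\Omega$. -/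

import Mathlib

open scoped ContDiff Polynomial

noncomputable section

/-! ### Functions of an endomorphism of a finite-dimensional real or complex vector space -/

/-- The canonical embedding of `𝕜 = ℝ` or `ℂ` into `ℂ`. -/
def toComplexHom (𝕜 : Type*) [RCLike 𝕜] : 𝕜 →+* ℂ where
  toFun z := (RCLike.re z : ℂ) + (RCLike.im z : ℂ) * Complex.I
  map_one' := by simp
  map_zero' := by simp
  map_add' x y := by simp only [map_add, Complex.ofReal_add]; ring
  map_mul' x y := by
    apply Complex.ext <;> simp

section MatFun

variable {𝕜 : Type*} [RCLike 𝕜] {V : Type*} [AddCommGroup V] [Module 𝕜 V]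
  [FiniteDimensional 𝕜 V]

/-- The characteristic polynomial of `T`, with complex coefficients. -/
def complexCharpoly (T : V →ₗ[𝕜] V) : ℂ[X] := T.charpoly.map (toComplexHom 𝕜)

/-- The spectrum of `T` in `ℂ`: its complex eigenvalues (also when `𝕜 = ℝ`). -/
def complexSpectrum (T : V →ₗ[𝕜] V) : Set ℂ := {z | (complexCharpoly T).IsRoot z}

/-- The polynomial `q` agrees with `f` on the spectrum of `T`: at each complex eigenvalue `z`, of
algebraic multiplicity `m`, the derivatives of order `< m` of `q` and of `f` are the same. -/
def Interpolates (f : ℂ → ℂ) (T : V →ₗ[𝕜] V) (q : 𝕜[X]) : Prop :=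
  ∀ z : ℂ, ∀ k < (complexCharpoly T).rootMultiplicity z,
    (Polynomial.derivative^[k] (q.map (toComplexHom 𝕜))).eval z = iteratedDeriv k f z

/-- `f(T)` does not depend on the interpolating polynomial. -/
theorem Interpolates.aeval_eq {f : ℂ → ℂ} {T : V →ₗ[𝕜] V} {q₁ q₂ : 𝕜[X]}
    (h₁ : Interpolates f T q₁) (h₂ : Interpolates f T q₂) :
    Polynomial.aeval T q₁ = Polynomial.aeval T q₂ := by
  by_cases hq : q₁ - q₂ = 0
  · rw [sub_eq_zero.mp hq]
  have hD : (q₁ - q₂).map (toComplexHom 𝕜) ≠ 0 :=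
    (Polynomial.map_ne_zero_iff (toComplexHom 𝕜).injective).mpr hq
  have hC : complexCharpoly T ≠ 0 :=
    ((LinearMap.charpoly_monic T).map _).ne_zero
  have hdvd : complexCharpoly T ∣ (q₁ - q₂).map (toComplexHom 𝕜) := by
    refine (IsAlgClosed.splits (complexCharpoly T)).dvd_of_roots_le_roots hC ?_
    rw [Multiset.le_iff_count]
    intro z
    rw [Polynomial.count_roots, Polynomial.count_roots]
    by_contra! hlt
    have hp : 0 < (complexCharpoly T).rootMultiplicity z := by omega
    have hkey := Polynomial.lt_rootMultiplicity_of_isRoot_iterate_derivative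
      (n := (complexCharpoly T).rootMultiplicity z - 1) (t := z) hD (fun m hm => by
        have e₁ := h₁ z m (by omega)
        have e₂ := h₂ z m (by omega)
        rw [Polynomial.IsRoot, Polynomial.map_sub, Polynomial.iterate_derivative_sub,
          Polynomial.eval_sub, e₁, e₂, sub_self])
    omega
  have hdvd' : T.charpoly ∣ q₁ - q₂ := (Polynomial.map_dvd_map' (toComplexHom 𝕜)).mp hdvd
  obtain ⟨s, hs⟩ := hdvd'
  have h0 : Polynomial.aeval T (q₁ - q₂) = 0 := by
    rw [hs, map_mul, LinearMap.aeval_self_charpoly, zero_mul]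
  rw [map_sub] at h0
  exact sub_eq_zero.mp h0

open Classical in
/-- The endomorphism `f(T)`, for `f` holomorphic near the spectrum of `T` (and, when `𝕜 = ℝ`,
commuting with complex conjugation): `f(T) = q(T)` for any polynomial `q` over `𝕜` that agrees with
`f` on the spectrum of `T`. The value is `0` if there is no such `q`. -/
def matFun (f : ℂ → ℂ) (T : V →ₗ[𝕜] V) : V →ₗ[𝕜] V :=
  if h : ∃ q : 𝕜[X], Interpolates f T q then Polynomial.aeval T h.choose else 0

/-- The exponential of an endomorphism, computed as a matrix exponential in a basis. -/
def linExp (T : V →ₗ[𝕜] V) : V →ₗ[𝕜] V :=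
  Matrix.toLin (Module.finBasis 𝕜 V) (Module.finBasis 𝕜 V)
    (NormedSpace.exp (LinearMap.toMatrix (Module.finBasis 𝕜 V) (Module.finBasis 𝕜 V) T))

end MatFun

/-- The meromorphic function `F(z) = coth z - 1/z`, with its removable singularity at `0` filled
in. Its poles are the points `iπn`, `n` a nonzero integer. -/
def cothF (z : ℂ) : ℂ := if z = 0 then 0 else Complex.cosh z / Complex.sinh z - 1 / z

/-! ### Open sets and smooth maps in finite-dimensional spaces, through linear coordinates -/

section Smooth

variable (𝕜 : Type*) [RCLike 𝕜] {V W : Type*} [AddCommGroup V] [Module 𝕜 V]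
  [AddCommGroup W] [Module 𝕜 W]

/-- Openness for the usual topology of a finite-dimensional space. -/
def IsOpenFD (U : Set V) : Prop :=
  ∀ (n : ℕ) (b : Module.Basis (Fin n) 𝕜 V), IsOpen {x : Fin n → 𝕜 | b.equivFun.symm x ∈ U}

/-- Smoothness on `U` (in the sense of `𝕜`) of a map between finite-dimensional spaces. -/
def SmoothOnFD (U : Set V) (f : V → W) : Prop :=
  ∀ (n : ℕ) (b : Module.Basis (Fin n) 𝕜 V) (w : Module.Dual 𝕜 W),
    ContDiffOn 𝕜 ∞ (fun x : Fin n → 𝕜 => w (f (b.equivFun.symm x)))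
      {x : Fin n → 𝕜 | b.equivFun.symm x ∈ U}

end Smooth

/-! ### Lie quasi-bialgebras -/

/-- A skew-symmetric linear map from `E*` to `E`. -/
def IsSkewMap {𝕜 E : Type*} [RCLike 𝕜] [AddCommGroup E] [Module 𝕜 E]
    (t : Module.Dual 𝕜 E →ₗ[𝕜] E) : Prop :=
  ∀ ξ η : Module.Dual 𝕜 E, η (t ξ) = -ξ (t η)

/-- A bilinear map that is a Lie bracket. -/
def IsLieBracket {𝕜 E : Type*} [RCLike 𝕜] [AddCommGroup E] [Module 𝕜 E]
    (B : E →ₗ[𝕜] E →ₗ[𝕜] E) : Prop :=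
  (∀ u, B u u = 0) ∧ ∀ u v w, B u (B v w) + B v (B w u) + B w (B u v) = 0

section LQB

variable {𝕜 : Type*} [RCLike 𝕜] {g : Type*} [LieRing g] [LieAlgebra 𝕜 g]

/-- `ad*_x`, the transpose of `ad_x`: `⟨ad*_x ξ, y⟩ = ⟨ξ, [x,y]⟩`. -/
def adStar (x : g) : Module.Dual 𝕜 g →ₗ[𝕜] Module.Dual 𝕜 g := (LieAlgebra.ad 𝕜 g x).dualMap

@[simp] theorem adStar_apply (x : g) (ξ : Module.Dual 𝕜 g) (y : g) :
    adStar x ξ y = ξ ⁅x, y⁆ := rfl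

section Trivector

variable (φ : Module.Dual 𝕜 g [⋀^Fin 3]→ₗ[𝕜] 𝕜) (a b ξ η ζ : Module.Dual 𝕜 g) (c : 𝕜)

theorem trivector_add₀ : φ ![a + b, η, ζ] = φ ![a, η, ζ] + φ ![b, η, ζ] := by
  have e : ∀ x, Function.update ![0, η, ζ] 0 x = ![x, η, ζ] := fun x => by
    funext i; fin_cases i <;> rfl
  simpa only [e] using φ.map_update_add ![0, η, ζ] 0 a b

theorem trivector_add₁ : φ ![ξ, a + b, ζ] = φ ![ξ, a, ζ] + φ ![ξ, b, ζ] := by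
  have e : ∀ x, Function.update ![ξ, 0, ζ] 1 x = ![ξ, x, ζ] := fun x => by
    funext i; fin_cases i <;> rfl
  simpa only [e] using φ.map_update_add ![ξ, 0, ζ] 1 a b

theorem trivector_add₂ : φ ![ξ, η, a + b] = φ ![ξ, η, a] + φ ![ξ, η, b] := by
  have e : ∀ x, Function.update ![ξ, η, 0] 2 x = ![ξ, η, x] := fun x => by
    funext i; fin_cases i <;> rfl
  simpa only [e] using φ.map_update_add ![ξ, η, 0] 2 a b

theorem trivector_smul₀ : φ ![c • a, η, ζ] = c * φ ![a, η, ζ] := by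
  have e : ∀ x, Function.update ![0, η, ζ] 0 x = ![x, η, ζ] := fun x => by
    funext i; fin_cases i <;> rfl
  simpa only [e, smul_eq_mul] using φ.map_update_smul ![0, η, ζ] 0 c a

theorem trivector_smul₁ : φ ![ξ, c • a, ζ] = c * φ ![ξ, a, ζ] := by
  have e : ∀ x, Function.update ![ξ, 0, ζ] 1 x = ![ξ, x, ζ] := fun x => by
    funext i; fin_cases i <;> rfl
  simpa only [e, smul_eq_mul] using φ.map_update_smul ![ξ, 0, ζ] 1 c a

theorem trivector_smul₂ : φ ![ξ, η, c • a] = c * φ ![ξ, η, a] := by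
  have e : ∀ x, Function.update ![ξ, η, 0] 2 x = ![ξ, η, x] := fun x => by
    funext i; fin_cases i <;> rfl
  simpa only [e, smul_eq_mul] using φ.map_update_smul ![ξ, η, 0] 2 c a

end Trivector

variable [FiniteDimensional 𝕜 g]

theorem ext_dual {x y : g} (h : ∀ ζ : Module.Dual 𝕜 g, ζ x = ζ y) : x = y := by
  rw [← sub_eq_zero, ← Module.forall_dual_apply_eq_zero_iff 𝕜]
  intro ζ
  rw [map_sub, h, sub_self]

/-- A trivector `φ ∈ ∧³g` is encoded by the alternating form `(ξ,η,ζ) ↦ ⟨ξ⊗η⊗ζ, φ⟩` on `g*`. This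
is the element `⟨ξ⊗η⊗1, φ⟩` of `g`, characterised by `⟨ζ, ⟨ξ⊗η⊗1, φ⟩⟩ = ⟨ξ⊗η⊗ζ, φ⟩`. -/
def contract (φ : Module.Dual 𝕜 g [⋀^Fin 3]→ₗ[𝕜] 𝕜) (ξ η : Module.Dual 𝕜 g) : g :=
  (Module.evalEquiv 𝕜 g).symm
    { toFun := fun ζ => φ ![ξ, η, ζ]
      map_add' := fun a b => trivector_add₂ φ a b ξ η
      map_smul' := fun c a => trivector_smul₂ φ a ξ η c }

@[simp] theorem apply_contract (φ : Module.Dual 𝕜 g [⋀^Fin 3]→ₗ[𝕜] 𝕜)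
    (ξ η ζ : Module.Dual 𝕜 g) : ζ (contract φ ξ η) = φ ![ξ, η, ζ] := by
  simp [contract]

/-- The bracket on `g ⊕ g*` defined by a linear map `ϖ : g → Hom(g*, g)` and a trivector `φ`:
`[x,y] = [x,y]_g`, `[x,ξ] = ϖ_x ξ - ad*_x ξ`, `[ξ,η] = ⟨η, ϖ_• ξ⟩ + ⟨ξ⊗η⊗1, φ⟩`
for `x, y ∈ g` and `ξ, η ∈ g*`. -/
def doubleBracket (ϖ : g →ₗ[𝕜] Module.Dual 𝕜 g →ₗ[𝕜] g)
    (φ : Module.Dual 𝕜 g [⋀^Fin 3]→ₗ[𝕜] 𝕜) :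
    (g × Module.Dual 𝕜 g) →ₗ[𝕜] (g × Module.Dual 𝕜 g) →ₗ[𝕜] (g × Module.Dual 𝕜 g) :=
  LinearMap.mk₂ 𝕜
    (fun u v =>
      (⁅u.1, v.1⁆ + ϖ u.1 v.2 - ϖ v.1 u.2 + contract φ u.2 v.2,
        -adStar u.1 v.2 + adStar v.1 u.2 + v.2 ∘ₗ ϖ.flip u.2))
    (fun u u' v => by
      refine Prod.ext (ext_dual (𝕜 := 𝕜) fun ζ => ?_) (LinearMap.ext fun y => ?_)
      · simp [trivector_add₀]; ring
      · simp; ring)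
    (fun c u v => by
      refine Prod.ext (ext_dual (𝕜 := 𝕜) fun ζ => ?_) (LinearMap.ext fun y => ?_)
      · simp [trivector_smul₀]; ring
      · simp)
    (fun u v v' => by
      refine Prod.ext (ext_dual (𝕜 := 𝕜) fun ζ => ?_) (LinearMap.ext fun y => ?_)
      · simp [trivector_add₁]; ring
      · simp; ring)
    (fun c u v => by
      refine Prod.ext (ext_dual (𝕜 := 𝕜) fun ζ => ?_) (LinearMap.ext fun y => ?_)
      · simp [trivector_smul₁]; ring
      · simp)

variable (𝕜 g) in
/-- A Lie quasi-bialgebra structure on the Lie algebra `g`: a `1`-cocycle `ϖ` of `g` with values in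
the skew-symmetric maps from `g*` to `g` and an associator `φ ∈ ∧³g` such that `g ⊕ g*` with the
bracket above is a Lie algebra, the canonical double. -/
structure LieQuasiBialgebra where
  ϖ : g →ₗ[𝕜] Module.Dual 𝕜 g →ₗ[𝕜] g
  φ : Module.Dual 𝕜 g [⋀^Fin 3]→ₗ[𝕜] 𝕜
  skew : ∀ x, IsSkewMap (ϖ x)
  cocycle : ∀ (x y : g) (ξ : Module.Dual 𝕜 g),
    ϖ ⁅x, y⁆ ξ = ⁅x, ϖ y ξ⁆ + ϖ y (adStar x ξ) - ⁅y, ϖ x ξ⁆ - ϖ x (adStar y ξ)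
  double_isLie : IsLieBracket (doubleBracket ϖ φ)

namespace LieQuasiBialgebra

/-- Cocommutative: the cocycle vanishes. -/
def IsCocommutative (G : LieQuasiBialgebra 𝕜 g) : Prop := G.ϖ = 0

/-- `ad^𝔡_p`, the adjoint action on the canonical double of an element `p ∈ g*`. -/
def adDouble (G : LieQuasiBialgebra 𝕜 g) (p : Module.Dual 𝕜 g) :
    (g × Module.Dual 𝕜 g) →ₗ[𝕜] (g × Module.Dual 𝕜 g) :=
  doubleBracket G.ϖ G.φ (0, p)

/-- The set of `p ∈ g*` such that `iπn` is not an eigenvalue of `ad^𝔡_p` for any integer `n ≠ 0`. -/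
def amDomain (G : LieQuasiBialgebra 𝕜 g) : Set (Module.Dual 𝕜 g) :=
  {p | ∀ n : ℤ, n ≠ 0 → Complex.I * Real.pi * n ∉ complexSpectrum (G.adDouble p)}

/-- The endomorphism `F(ad^𝔡_p)` of the double, `F(z) = coth z - 1/z`. -/
def amDouble (G : LieQuasiBialgebra 𝕜 g) (p : Module.Dual 𝕜 g) :
    (g × Module.Dual 𝕜 g) →ₗ[𝕜] (g × Module.Dual 𝕜 g) :=
  matFun cothF (G.adDouble p)

/-- The map `r^AM_p : g* → g` given by `F(ad^𝔡_p)`. -/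
def rAM (G : LieQuasiBialgebra 𝕜 g) (p : Module.Dual 𝕜 g) : Module.Dual 𝕜 g →ₗ[𝕜] g :=
  LinearMap.fst 𝕜 g (Module.Dual 𝕜 g) ∘ₗ G.amDouble p ∘ₗ LinearMap.inr 𝕜 g (Module.Dual 𝕜 g)

end LieQuasiBialgebra

end LQB

/-! ### Dynamical matrices -/

section Dynamical

variable {𝕜 : Type*} [RCLike 𝕜] {g : Type*} [LieRing g] [LieAlgebra 𝕜 g] [FiniteDimensional 𝕜 g]
  {l : Type*} [LieRing l] [LieAlgebra 𝕜 l] [FiniteDimensional 𝕜 l]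

/-- `U ⊆ l*` is invariant under the coadjoint action of a connected Lie group `L` with Lie algebra
`l`. As `L` is generated by the `exp z`, `z ∈ l`, and `Ad_{exp z} = e^{ad z}`, this means invariance
under all the maps `p ↦ p ∘ e^{ad z}`. -/
def IsCoadInvariant (U : Set (Module.Dual 𝕜 l)) : Prop :=
  ∀ (z : l), ∀ p ∈ U, p ∘ₗ linExp (LieAlgebra.ad 𝕜 l z) ∈ U

/-- `r : U → {skew-symmetric maps from g* to g}` is a dynamical `ℓ`-matrix on the open,
coadjoint-invariant set `U ⊆ l*` associated with the Lie quasi-bialgebra `G`; here `l` is the Lie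
subalgebra of `g` with inclusion `i`. Only the values of `r` on `U` matter. The derivative `d_p r(α)`
in the direction `α ∈ l*` is written through the scalar functions `q ↦ ⟨ζ, r_q η⟩`. -/
structure IsDynamicalLMatrix (G : LieQuasiBialgebra 𝕜 g) (i : l →ₗ⁅𝕜⁆ g)
    (U : Set (Module.Dual 𝕜 l)) (r : Module.Dual 𝕜 l → Module.Dual 𝕜 g →ₗ[𝕜] g) : Prop where
  injective : Function.Injective i
  isOpen : IsOpenFD 𝕜 U
  invariant : IsCoadInvariant U
  skew : ∀ p ∈ U, IsSkewMap (r p)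
  smooth : SmoothOnFD 𝕜 U r
  /-- The generalized classical dynamical Yang-Baxter equation: the sum over the cyclic permutations
  of `(ξ, η, ζ)` of `⟨ζ, d_p r(i*ξ)η⟩ - ⟨ζ, [r_p ξ, r_p η]⟩ - ⟨ζ, ϖ_{r_p ξ} η⟩` is
  `⟨ξ⊗η⊗ζ, φ⟩`. -/
  cdybe : ∀ p ∈ U, ∀ ξ η ζ : Module.Dual 𝕜 g,
    (lineDeriv 𝕜 (fun q => ζ (r q η)) p (ξ ∘ₗ (i : l →ₗ[𝕜] g))
        - ζ ⁅r p ξ, r p η⁆ - ζ (G.ϖ (r p ξ) η))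
      + (lineDeriv 𝕜 (fun q => ξ (r q ζ)) p (η ∘ₗ (i : l →ₗ[𝕜] g))
        - ξ ⁅r p η, r p ζ⁆ - ξ (G.ϖ (r p η) ζ))
      + (lineDeriv 𝕜 (fun q => η (r q ξ)) p (ζ ∘ₗ (i : l →ₗ[𝕜] g))
        - η ⁅r p ζ, r p ξ⁆ - η (G.ϖ (r p ζ) ξ))
      = G.φ ![ξ, η, ζ]
  /-- Equivariance: `d_p r(ad*_z p) + ϖ_{iz} + ad_{iz} r_p + r_p ad*_{iz} = 0` for `z ∈ l`. -/
  equivariant : ∀ p ∈ U, ∀ (z : l) (ξ η : Module.Dual 𝕜 g),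
    lineDeriv 𝕜 (fun q => η (r q ξ)) p (adStar z p)
      + η (G.ϖ (i z) ξ + ⁅i z, r p ξ⁆ + r p (adStar (i z) ξ)) = 0

/-- A dynamical `r`-matrix on `U ⊆ g*` associated with `G`: a dynamical `ℓ`-matrix, in the case
`l = g`, associated with a cocommutative Lie quasi-bialgebra. -/
def IsDynamicalRMatrix (G : LieQuasiBialgebra 𝕜 g) (U : Set (Module.Dual 𝕜 g))
    (r : Module.Dual 𝕜 g → Module.Dual 𝕜 g →ₗ[𝕜] g) : Prop :=
  G.IsCocommutative ∧ IsDynamicalLMatrix G (LieHom.id : g →ₗ⁅𝕜⁆ g) U r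

end Dynamical

end

/-! Write `F = cothNum / sinhc`, where `sinhc z = sinh z / z` and `cothNum z = (cosh z - sinh z / z)
/ z` are entire with real Taylor coefficients and the zeros of `sinhc` are exactly the points `iπn`,
`n ≠ 0`. Then `F(T)` makes sense exactly where `sinhc T` is invertible: an open condition, under
which `F` is smooth. `cothSub` is this analytic form. On the operators killed by a polynomial `m`
without roots at the poles, `F(T) = q(T)` for one interpolating polynomial `q` (`cothSub_eq_aeval`).
Analysis uses the first form and algebra the second. The derivative of `F` at `T` along `Y` is the
corner of `F` at the block matrix with diagonal `(T, T)` and corner `Y`.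

The dynamical Yang-Baxter equation is the addition theorem of `coth`. If `a + b + c = 0`, then `coth
a coth b + coth b coth c + coth c coth a = -1`. Substituting `coth = F + 1/z` gives `F[-c,b] +
F[-a,c] + F[-b,a] - (F(a)F(b) + F(b)F(c) + F(c)F(a)) = 1`, where `F[x,y]` is the divided difference.
Apply this to the bracket `t` of the double, with `a`, `b`, `c` the actions of `T = ad_p` on its
first argument, of `T` on its second argument, and of `-T` on its value. These commute, and `(a + b
+ c) t = 0` because `T` is a derivation. Paired with `ξ, η, ζ ∈ g*`, the divided differences become
the derivatives of `F(ad_p)`, the products become brackets of values of `r`, and the right side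
becomes `φ` (`trilinear_functional_equation`, `cdybe_rAM`).

The rest is symmetry. `F` is odd, while `ad_p` is skew for the invariant pairing and odd for the
grading with `g` even and `g*` odd; hence skewness of `r` and `F(ad_p) g* ⊆ g`. Equivariance is the
derivative of `F` along a commutator. Coadjoint invariance holds because exponentials of inner
derivations are automorphisms of the double. For an invariant `Ω`, the map `(x, ξ) ↦ x + Ω ξ`
intertwines `ad_p` with `ad_{Ω p}`, hence also polynomials in them. -/

noncomputable section

open scoped Nat Topology
open Filter

/-! ### Entire functions with real coefficients in Banach algebras -/

section EntireSum

variable (𝕜 : Type*) [RCLike 𝕜]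

/-- The sum of the power series with real coefficients `c` at the point `T` of a `𝕜`-algebra. -/
def entireSum {R : Type*} [Ring R] [Algebra 𝕜 R] [TopologicalSpace R] (c : ℕ → ℝ) (T : R) : R :=
  ∑' n, (c n : 𝕜) • T ^ n

/-- Domination of the coefficients by those of the exponential series. -/
def FactorialBounded (c : ℕ → ℝ) : Prop := ∀ n, |c n| ≤ ((n ! : ℝ))⁻¹

variable {R : Type*} [NormedRing R] [NormedAlgebra 𝕜 R]
variable {R' : Type*} [NormedRing R'] [NormedAlgebra 𝕜 R']

theorem ofScalars_radius_eq_top {c : ℕ → ℝ} (hc : FactorialBounded c) :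
    (FormalMultilinearSeries.ofScalars R (fun n => (c n : 𝕜))).radius = ⊤ := by
  refine FormalMultilinearSeries.radius_eq_top_of_summable_norm _ fun r => ?_
  refine Summable.of_norm_bounded_eventually_nat
    (g := fun n => (r : ℝ) ^ n / n !) (Real.summable_pow_div_factorial r) ?_
  -- Index `0` is excluded because the norm of `1` in `R` need not be `1`.
  filter_upwards [eventually_gt_atTop 0] with n hn
  have h1 := FormalMultilinearSeries.ofScalars_norm_le R (fun n => (c n : 𝕜)) n hn
  have h2 := hc n
  simp only [RCLike.norm_ofReal] at h1
  rw [Real.norm_of_nonneg (by positivity), div_eq_inv_mul]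
  gcongr
  exact h1.trans h2

variable [CompleteSpace R]

theorem hasFPowerSeriesOnBall_entireSum {c : ℕ → ℝ} (hc : FactorialBounded c) :
    HasFPowerSeriesOnBall (entireSum 𝕜 c : R → R)
      (FormalMultilinearSeries.ofScalars R (fun n => (c n : 𝕜))) 0 ⊤ := by
  have h := (FormalMultilinearSeries.ofScalars R (fun n => (c n : 𝕜))).hasFPowerSeriesOnBall
    (by rw [ofScalars_radius_eq_top 𝕜 hc]; exact ENNReal.zero_lt_top)
  rw [ofScalars_radius_eq_top 𝕜 hc] at h
  have e : (entireSum 𝕜 c : R → R) =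
      (FormalMultilinearSeries.ofScalars R (fun n => (c n : 𝕜))).sum :=
    (FormalMultilinearSeries.ofScalarsSum_eq_tsum (E := R) (fun n => (c n : 𝕜))).symm
  rwa [e]

theorem hasSum_entireSum {c : ℕ → ℝ} (hc : FactorialBounded c) (T : R) :
    HasSum (fun n => (c n : 𝕜) • T ^ n) (entireSum 𝕜 c T) := by
  have h := (hasFPowerSeriesOnBall_entireSum 𝕜 (R := R) hc).hasSum (y := T) (by simp)
  rw [zero_add] at h
  simpa only [FormalMultilinearSeries.ofScalars_apply_eq] using h

theorem contDiff_entireSum {c : ℕ → ℝ} (hc : FactorialBounded c) :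
    ContDiff 𝕜 ∞ (entireSum 𝕜 c : R → R) := by
  have h := (hasFPowerSeriesOnBall_entireSum 𝕜 (R := R) hc).analyticOnNhd
  rw [Metric.eball_top] at h
  exact contDiffOn_univ.mp (h.contDiffOn uniqueDiffOn_univ)

theorem map_entireSum [CompleteSpace R'] {c : ℕ → ℝ} (hc : FactorialBounded c) (f : R →ₐ[𝕜] R')
    (hf : Continuous f) (T : R) : f (entireSum 𝕜 c T) = entireSum 𝕜 c (f T) := by
  have h := (hasSum_entireSum 𝕜 hc T).map f hf
  refine h.unique ?_
  simpa [Function.comp_def] using hasSum_entireSum 𝕜 hc (f T)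

end EntireSum

/-! ### `sinh z / z` and `(cosh z - sinh z / z) / z` -/

/-- The Taylor coefficients of `sinh z / z`. -/
def sinhcCoeff (n : ℕ) : ℝ := (1 + (-1) ^ n) / (2 * (n + 1)!)

/-- The Taylor coefficients of `(cosh z - sinh z / z) / z`. -/
def cothNumCoeff (n : ℕ) : ℝ := (1 - (-1) ^ n) * (n + 1) / (2 * (n + 2)!)

theorem factorialBounded_sinhcCoeff : FactorialBounded sinhcCoeff := by
  intro n
  have h0 : (0:ℝ) < n ! := by positivity
  have h1 : (n + 1)! = (n + 1 : ℝ) * n ! := by push_cast [Nat.factorial_succ]; ring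
  rw [sinhcCoeff]
  rcases neg_one_pow_eq_or ℝ n with h | h <;> rw [h, h1]
  · rw [abs_of_nonneg (by positivity), inv_eq_one_div, div_le_div_iff₀ (by positivity) h0]
    nlinarith [mul_nonneg (Nat.cast_nonneg (α := ℝ) n) h0.le]
  · simp

theorem factorialBounded_cothNumCoeff : FactorialBounded cothNumCoeff := by
  intro n
  have h0 : (0:ℝ) < n ! := by positivity
  have h1 : (n + 2)! = (n + 2 : ℝ) * (n + 1) * n ! := by push_cast [Nat.factorial_succ]; ring
  rw [cothNumCoeff]
  rcases neg_one_pow_eq_or ℝ n with h | h <;> rw [h, h1]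
  · simp
  · rw [abs_of_nonneg (by norm_num; positivity), inv_eq_one_div,
      div_le_div_iff₀ (by positivity) h0]
    have h2 : (0 : ℝ) ≤ (n + 1) * n ! := by positivity
    nlinarith [mul_nonneg (Nat.cast_nonneg (α := ℝ) n) h2]

section Coth

variable (𝕜 : Type*) [RCLike 𝕜]

/-- The entire function `sinh z / z` evaluated at an element of an algebra. -/
def sinhc {R : Type*} [Ring R] [Algebra 𝕜 R] [TopologicalSpace R] (T : R) : R :=
  entireSum 𝕜 sinhcCoeff T

/-- The entire function `(cosh z - sinh z / z) / z` evaluated at an element of an algebra. -/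
def cothNum {R : Type*} [Ring R] [Algebra 𝕜 R] [TopologicalSpace R] (T : R) : R :=
  entireSum 𝕜 cothNumCoeff T

/-- The function `coth z - 1 / z` evaluated at an element `T` of an algebra, in the case that
`sinhc T` is invertible. -/
def cothSub {R : Type*} [Ring R] [Algebra 𝕜 R] [TopologicalSpace R] (T : R) : R :=
  Ring.inverse (sinhc 𝕜 T) * cothNum 𝕜 T

variable {R : Type*} [NormedRing R] [NormedAlgebra 𝕜 R]

theorem sinhc_mul_cothSub {T : R} (h : IsUnit (sinhc 𝕜 T)) :
    sinhc 𝕜 T * cothSub 𝕜 T = cothNum 𝕜 T := by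
  rw [cothSub, ← mul_assoc, Ring.mul_inverse_cancel _ h, one_mul]

theorem cothSub_eq_of_sinhc_mul_eq {T x : R} (h : IsUnit (sinhc 𝕜 T))
    (hx : sinhc 𝕜 T * x = cothNum 𝕜 T) : cothSub 𝕜 T = x := by
  rw [cothSub, ← hx, ← mul_assoc, Ring.inverse_mul_cancel _ h, one_mul]

variable [CompleteSpace R]
variable {R' : Type*} [NormedRing R'] [NormedAlgebra 𝕜 R'] [CompleteSpace R']

theorem two_mul_mul_sinhc (T : R) :
    2 * (T * sinhc 𝕜 T) = NormedSpace.exp T - NormedSpace.exp (-T) := by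
  have h1 := ((hasSum_entireSum 𝕜 factorialBounded_sinhcCoeff T).mul_left T).mul_left 2
  have h2 := (NormedSpace.exp_series_hasSum_exp' (𝕂 := 𝕜) T).sub
    (NormedSpace.exp_series_hasSum_exp' (𝕂 := 𝕜) (-T))
  -- The constant terms cancel; dropping them matches the powers `T ^ (n + 1)` on the other side.
  rw [← hasSum_nat_add_iff' 1] at h2
  simp only [Finset.range_one, Finset.sum_singleton, pow_zero, sub_self, sub_zero] at h2
  refine h1.unique ?_
  have e : (fun n => 2 * (T * ((sinhcCoeff n : ℝ) : 𝕜) • T ^ n)) = fun n =>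
      (((n + 1)! : 𝕜))⁻¹ • T ^ (n + 1) - (((n + 1)! : 𝕜))⁻¹ • (-T) ^ (n + 1) := by
    funext n
    have e1 : (-T) ^ (n + 1) = ((-1) ^ (n + 1) : 𝕜) • T ^ (n + 1) := by
      rw [← smul_pow, neg_one_smul]
    rw [mul_smul_comm, ← pow_succ', e1, smul_smul, ← sub_smul, two_mul, ← add_smul]
    congr 1
    have h0 : ((n + 1)! : 𝕜) ≠ 0 := by exact_mod_cast (Nat.factorial_pos _).ne'
    rw [sinhcCoeff]
    push_cast
    field_simp
    ring
  rw [e]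
  exact h2

/-- This is `cosh = sinhc + z * cothNum`. Subtracting the series of `2 * sinhc` from that of `exp T
+ exp (-T)` kills the constant term `1 + 1 - 2`, and what remains is divisible by `T`. -/
theorem two_mul_sinhc_add (T : R) :
    2 * (sinhc 𝕜 T + T * cothNum 𝕜 T) = NormedSpace.exp T + NormedSpace.exp (-T) := by
  have h1 := ((hasSum_entireSum 𝕜 factorialBounded_cothNumCoeff T).mul_left T).mul_left 2
  have h2 := ((NormedSpace.exp_series_hasSum_exp' (𝕂 := 𝕜) T).add
    (NormedSpace.exp_series_hasSum_exp' (𝕂 := 𝕜) (-T))).sub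
    ((hasSum_entireSum 𝕜 factorialBounded_sinhcCoeff T).mul_left 2)
  rw [← hasSum_nat_add_iff' 1] at h2
  have e0 : (∑ i ∈ Finset.range 1, (((i ! : 𝕜))⁻¹ • T ^ i + ((i ! : 𝕜))⁻¹ • (-T) ^ i
      - 2 * ((sinhcCoeff i : ℝ) : 𝕜) • T ^ i)) = 0 := by
    have : sinhcCoeff 0 = 1 := by norm_num [sinhcCoeff]
    simp [this, one_add_one_eq_two]
  rw [e0, sub_zero] at h2
  have e : (fun n => 2 * (T * ((cothNumCoeff n : ℝ) : 𝕜) • T ^ n)) = fun n =>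
      ((((n + 1)! : 𝕜))⁻¹ • T ^ (n + 1) + (((n + 1)! : 𝕜))⁻¹ • (-T) ^ (n + 1)
      - 2 * ((sinhcCoeff (n + 1) : ℝ) : 𝕜) • T ^ (n + 1)) := by
    funext n
    have e1 : (-T) ^ (n + 1) = ((-1) ^ (n + 1) : 𝕜) • T ^ (n + 1) := by
      rw [← smul_pow, neg_one_smul]
    rw [mul_smul_comm, ← pow_succ', e1, smul_smul, ← add_smul, two_mul, two_mul, ← add_smul,
      ← add_smul, ← sub_smul]
    congr 1
    have h0 : ((n + 1)! : 𝕜) ≠ 0 := by exact_mod_cast (Nat.factorial_pos _).ne'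
    have h3 : (n + 1 + 1 : 𝕜) ≠ 0 := by exact_mod_cast (Nat.succ_ne_zero (n + 1))
    have h4 : ((n + 2)! : 𝕜) = (n + 1 + 1) * ((n + 1)! : 𝕜) := by
      push_cast [Nat.factorial_succ (n + 1)]; ring
    rw [sinhcCoeff, cothNumCoeff]
    push_cast
    rw [show n + 1 + 1 = n + 2 from rfl, h4]
    field_simp
    ring
  rw [← e] at h2
  have h5 := h1.unique h2
  change 2 * (entireSum 𝕜 sinhcCoeff T + T * entireSum 𝕜 cothNumCoeff T) = _
  rw [mul_add, h5]
  abel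

theorem sinhc_neg (T : R) : sinhc 𝕜 (-T) = sinhc 𝕜 T := by
  refine (hasSum_entireSum 𝕜 factorialBounded_sinhcCoeff (-T)).unique ?_
  have e : (fun n => ((sinhcCoeff n : ℝ) : 𝕜) • (-T) ^ n) =
      fun n => ((sinhcCoeff n : ℝ) : 𝕜) • T ^ n := by
    funext n
    rcases n.even_or_odd with h | h
    · rw [h.neg_pow]
    · simp [sinhcCoeff, h.neg_one_pow]
  rw [e]
  exact hasSum_entireSum 𝕜 factorialBounded_sinhcCoeff T

theorem cothNum_neg (T : R) : cothNum 𝕜 (-T) = -cothNum 𝕜 T := by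
  refine (hasSum_entireSum 𝕜 factorialBounded_cothNumCoeff (-T)).unique ?_
  have e : (fun n => ((cothNumCoeff n : ℝ) : 𝕜) • (-T) ^ n) =
      fun n => -(((cothNumCoeff n : ℝ) : 𝕜) • T ^ n) := by
    funext n
    rcases n.even_or_odd with h | h
    · simp [cothNumCoeff, h.neg_one_pow]
    · rw [h.neg_pow, smul_neg]
  rw [e]
  exact (hasSum_entireSum 𝕜 factorialBounded_cothNumCoeff T).neg

/-- An even denominator and an odd numerator. This parity is the source of the skew-symmetry of `r`
and of its taking values in `g`. -/
theorem cothSub_neg (T : R) : cothSub 𝕜 (-T) = -cothSub 𝕜 T := by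
  rw [cothSub, sinhc_neg, cothNum_neg, mul_neg, cothSub]

theorem sinhc_zero : sinhc 𝕜 (0 : R) = 1 := by
  refine (hasSum_entireSum 𝕜 factorialBounded_sinhcCoeff (0 : R)).unique ?_
  have h := hasSum_single (f := fun n => ((sinhcCoeff n : ℝ) : 𝕜) • (0 : R) ^ n) 0
    fun n hn => by simp [hn]
  simpa [sinhcCoeff] using h

theorem contDiff_sinhc : ContDiff 𝕜 ∞ (sinhc 𝕜 : R → R) :=
  contDiff_entireSum 𝕜 factorialBounded_sinhcCoeff

theorem isOpen_isUnit_sinhc : IsOpen {T : R | IsUnit (sinhc 𝕜 T)} :=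
  Units.isOpen.preimage (contDiff_sinhc 𝕜).continuous

theorem contDiffAt_cothSub {T : R} (h : IsUnit (sinhc 𝕜 T)) :
    ContDiffAt 𝕜 ∞ (cothSub 𝕜 : R → R) T := by
  obtain ⟨u, hu⟩ := h
  have h1 : ContDiffAt 𝕜 ∞ (Ring.inverse : R → R) (sinhc 𝕜 T) := hu ▸ contDiffAt_ringInverse 𝕜 u
  exact (h1.comp T (contDiff_sinhc 𝕜).contDiffAt).mul
    (contDiff_entireSum 𝕜 factorialBounded_cothNumCoeff).contDiffAt

theorem map_sinhc (f : R →ₐ[𝕜] R') (hf : Continuous f) (T : R) :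
    f (sinhc 𝕜 T) = sinhc 𝕜 (f T) :=
  map_entireSum 𝕜 factorialBounded_sinhcCoeff f hf T

theorem map_cothSub (f : R →ₐ[𝕜] R') (hf : Continuous f) {T : R} (h : IsUnit (sinhc 𝕜 T)) :
    f (cothSub 𝕜 T) = cothSub 𝕜 (f T) := by
  have e : f (Ring.inverse (sinhc 𝕜 T)) = Ring.inverse (sinhc 𝕜 (f T)) := by
    obtain ⟨u, hu⟩ := h
    have h1 : sinhc 𝕜 (f T) = (Units.map (f : R →* R') u : R') := by
      rw [← map_sinhc 𝕜 f hf, ← hu]; rfl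
    rw [h1, Ring.inverse_unit, ← hu, Ring.inverse_unit]
    rfl
  rw [cothSub, map_mul, e, cothNum, map_entireSum 𝕜 factorialBounded_cothNumCoeff f hf]
  rfl

end Coth

end

noncomputable section

open scoped Nat Topology
open Filter

/-! ### Functions of upper triangular `2 × 2` block matrices -/

section Block

attribute [local instance] Matrix.linftyOpNormedRing Matrix.linftyOpNormedAlgebra

variable (𝕜 : Type*) [RCLike 𝕜]

section Algebraic

variable {A : Type*} [Ring A] [Algebra 𝕜 A]

/-- Conjugation of the diagonal matrix `(x, y)` by the unipotent matrix with corner `t`. -/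
def shearHom (t : A) : A × A →ₐ[𝕜] Matrix (Fin 2) (Fin 2) A where
  toFun z := !![z.1, t * z.2 - z.1 * t; 0, z.2]
  map_one' := by simp [Matrix.one_fin_two]
  map_mul' z w := by
    simp only [Prod.fst_mul, Prod.snd_mul, Matrix.mul_fin_two]
    congr 4 <;> noncomm_ring
  map_zero' := by ext i j; fin_cases i <;> fin_cases j <;> simp
  map_add' z w := by
    ext i j; fin_cases i <;> fin_cases j <;> simp
    noncomm_ring
  commutes' r := by
    ext i j
    fin_cases i <;> fin_cases j <;> simp [Matrix.algebraMap_matrix_apply, Algebra.commutes]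

theorem shearHom_apply (t x y : A) : shearHom 𝕜 t (x, y) = !![x, t * y - x * t; 0, y] := rfl

theorem exists_aeval_block (x y Y : A) (p : 𝕜[X]) :
    ∃ Z, Polynomial.aeval !![x, Y; 0, y] p =
      !![Polynomial.aeval x p, Z; 0, Polynomial.aeval y p] := by
  induction p using Polynomial.induction_on' with
  | add p q hp hq =>
    obtain ⟨Z, hZ⟩ := hp
    obtain ⟨W, hW⟩ := hq
    refine ⟨Z + W, ?_⟩
    rw [map_add, hZ, hW, map_add, map_add]
    ext i j; fin_cases i <;> fin_cases j <;> simp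
  | monomial n a =>
    have h : ∃ Z, !![x, Y; 0, y] ^ n = !![x ^ n, Z; 0, y ^ n] := by
      induction n with
      | zero => exact ⟨0, by simp [Matrix.one_fin_two]⟩
      | succ n ih =>
        obtain ⟨Z, hZ⟩ := ih
        refine ⟨x ^ n * Y + Z * y, ?_⟩
        rw [pow_succ, hZ, Matrix.mul_fin_two]
        simp [pow_succ]
    obtain ⟨Z, hZ⟩ := h
    refine ⟨a • Z, ?_⟩
    simp only [Polynomial.aeval_monomial, hZ, ← Algebra.smul_def]
    ext i j; fin_cases i <;> fin_cases j <;> simp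

/-- The value of `p` is strictly upper triangular, so its square is zero. Hence interpolation modulo
`m ^ 2`, rather than `m`, is what controls derivatives and divided differences below. -/
theorem aeval_block_sq {x y : A} (Y : A) {p : 𝕜[X]} (hx : Polynomial.aeval x p = 0)
    (hy : Polynomial.aeval y p = 0) : Polynomial.aeval !![x, Y; 0, y] (p ^ 2) = 0 := by
  obtain ⟨Z, hZ⟩ := exists_aeval_block 𝕜 x y Y p
  rw [map_pow, hZ, hx, hy, pow_two, Matrix.mul_fin_two]
  ext i j; fin_cases i <;> fin_cases j <;> simp

end Algebraic

variable {A : Type*} [NormedRing A]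

theorem completeSpace_block [CompleteSpace A] :
    @CompleteSpace (Matrix (Fin 2) (Fin 2) A) PseudoMetricSpace.toUniformSpace :=
  inferInstanceAs (CompleteSpace (Fin 2 → Fin 2 → A))

attribute [local instance] completeSpace_block

theorem continuous_block {X : Type*} [TopologicalSpace X] {f g h : X → A} (hf : Continuous f)
    (hg : Continuous g) (hh : Continuous h) :
    Continuous fun s => (!![f s, g s; 0, h s] : Matrix (Fin 2) (Fin 2) A) := by
  refine continuous_matrix fun i j => ?_
  fin_cases i <;> fin_cases j <;> simp <;> fun_prop

variable [NormedAlgebra 𝕜 A]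

theorem continuous_shearHom (t : A) : Continuous (shearHom 𝕜 t) :=
  continuous_block continuous_fst (by fun_prop) continuous_snd

variable [CompleteSpace A]

theorem isUnit_sinhc_prod {x y : A} (hx : IsUnit (sinhc 𝕜 x)) (hy : IsUnit (sinhc 𝕜 y)) :
    IsUnit (sinhc 𝕜 ((x, y) : A × A)) := by
  have e : sinhc 𝕜 ((x, y) : A × A) = (sinhc 𝕜 x, sinhc 𝕜 y) := by
    refine Prod.ext ?_ ?_
    · exact map_sinhc 𝕜 (AlgHom.fst 𝕜 A A) continuous_fst (x, y)
    · exact map_sinhc 𝕜 (AlgHom.snd 𝕜 A A) continuous_snd (x, y)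
  rw [e, Prod.isUnit_iff]
  exact ⟨hx, hy⟩

theorem cothSub_prod {x y : A} (hx : IsUnit (sinhc 𝕜 x)) (hy : IsUnit (sinhc 𝕜 y)) :
    cothSub 𝕜 ((x, y) : A × A) = (cothSub 𝕜 x, cothSub 𝕜 y) := by
  refine Prod.ext ?_ ?_
  · exact map_cothSub 𝕜 (AlgHom.fst 𝕜 A A) continuous_fst (isUnit_sinhc_prod 𝕜 hx hy)
  · exact map_cothSub 𝕜 (AlgHom.snd 𝕜 A A) continuous_snd (isUnit_sinhc_prod 𝕜 hx hy)

/-- A solution `t` of the Sylvester equation exhibits the block matrix as a unipotent conjugate of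
the diagonal one, and `F` commutes with algebra homomorphisms. -/
theorem cothSub_block {x y t Y : A} (hx : IsUnit (sinhc 𝕜 x)) (hy : IsUnit (sinhc 𝕜 y))
    (ht : t * y - x * t = Y) : cothSub 𝕜 !![x, Y; 0, y] =
      !![cothSub 𝕜 x, t * cothSub 𝕜 y - cothSub 𝕜 x * t; 0, cothSub 𝕜 y] := by
  have h := map_cothSub 𝕜 _ (continuous_shearHom 𝕜 t) (isUnit_sinhc_prod 𝕜 hx hy)
  rw [cothSub_prod 𝕜 hx hy, shearHom_apply, shearHom_apply, ht] at h
  exact h.symm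

/-- The derivative of `F` at `T` in the direction `Y` is the corner of the value of `F` at the block
matrix with diagonal `(T, T)` and corner `Y`. -/
theorem tendsto_slope_cothSub {T Y : A} (hT : IsUnit (sinhc 𝕜 T))
    (hB : IsUnit (sinhc 𝕜 !![T, Y; 0, T])) :
    Tendsto (fun s : 𝕜 => s⁻¹ • (cothSub 𝕜 (T + s • Y) - cothSub 𝕜 T)) (𝓝[≠] 0)
      (𝓝 (cothSub 𝕜 !![T, Y; 0, T] 0 1)) := by
  -- With diagonal `(T, T + s • Y)` the Sylvester equation is solved by the scalar `s⁻¹`. For small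
  -- `s ≠ 0` the corner of `F` is therefore the difference quotient itself, and continuity at `s =
  -- 0` gives the limit.
  have hc : Continuous fun s : 𝕜 => (!![T, Y; 0, T + s • Y] : Matrix (Fin 2) (Fin 2) A) :=
    continuous_block continuous_const continuous_const (by fun_prop)
  have h0 : (!![T, Y; 0, T + (0 : 𝕜) • Y] : Matrix (Fin 2) (Fin 2) A) = !![T, Y; 0, T] := by simp
  have hF : ContinuousAt (cothSub 𝕜) (!![T, Y; 0, T + (0 : 𝕜) • Y] : Matrix (Fin 2) (Fin 2) A) := by
    rw [h0]; exact (contDiffAt_cothSub 𝕜 hB).continuousAt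
  have h1 := (hF.comp (f := fun s : 𝕜 => (!![T, Y; 0, T + s • Y] : Matrix (Fin 2) (Fin 2) A))
    hc.continuousAt).tendsto
  have h2 : Tendsto (fun s : 𝕜 => cothSub 𝕜 !![T, Y; 0, T + s • Y] 0 1) (𝓝 0)
      (𝓝 (cothSub 𝕜 !![T, Y; 0, T] 0 1)) := by
    have h3 : Continuous fun M : Matrix (Fin 2) (Fin 2) A => M 0 1 :=
      continuous_id.matrix_elem 0 1
    have h4 := (h3.tendsto _).comp h1
    simp only [Function.comp_def, h0] at h4
    exact h4
  refine (h2.mono_left nhdsWithin_le_nhds).congr' ?_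
  have hu : ∀ᶠ s : 𝕜 in 𝓝 0, IsUnit (sinhc 𝕜 (T + s • Y)) := by
    have hcc : Continuous fun s : 𝕜 => T + s • Y := by fun_prop
    refine hcc.continuousAt.eventually_mem ((isOpen_isUnit_sinhc 𝕜).mem_nhds ?_)
    simpa using hT
  filter_upwards [hu.filter_mono nhdsWithin_le_nhds, self_mem_nhdsWithin] with s hs hs0
  have ht : algebraMap 𝕜 A s⁻¹ * (T + s • Y) - T * algebraMap 𝕜 A s⁻¹ = Y := by
    rw [← Algebra.smul_def, ← Algebra.commutes, ← Algebra.smul_def, smul_add,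
      smul_smul, inv_mul_cancel₀ hs0]
    simp
  rw [cothSub_block 𝕜 hT hs ht]
  simp [← Algebra.commutes s⁻¹ (cothSub 𝕜 T), ← Algebra.smul_def, smul_sub]

end Block

end

noncomputable section

open scoped Nat Topology
open Filter

/-! ### A norm on a finite-dimensional algebra -/

section AlgebraNorm

attribute [local instance] Matrix.linftyOpNormedRing Matrix.linftyOpNormedAlgebra

variable (𝕜 : Type*) [RCLike 𝕜] (A : Type*) [Ring A] [Algebra 𝕜 A] [FiniteDimensional 𝕜 A]

/-- A norm on a finite-dimensional algebra, through the left regular representation. -/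
abbrev leftRegularNormedRing : NormedRing A :=
  NormedRing.induced A _ (Algebra.leftMulMatrix (Module.finBasis 𝕜 A))
    (Algebra.leftMulMatrix_injective _)

/-- The normed algebra structure for the left regular norm. -/
abbrev leftRegularNormedAlgebra :
    @NormedAlgebra 𝕜 A _ (leftRegularNormedRing 𝕜 A).toSeminormedRing :=
  NormedAlgebra.induced 𝕜 A _ (Algebra.leftMulMatrix (Module.finBasis 𝕜 A))

end AlgebraNorm

/-! ### The scalar functions -/

theorem mul_sinhc_complex (z : ℂ) : z * sinhc ℂ z = Complex.sinh z := by
  have h := two_mul_mul_sinhc ℂ z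
  rw [← Complex.exp_eq_exp_ℂ] at h
  rw [Complex.sinh, ← h]
  ring

theorem sinhc_add_complex (z : ℂ) : sinhc ℂ z + z * cothNum ℂ z = Complex.cosh z := by
  have h := two_mul_sinhc_add ℂ z
  rw [← Complex.exp_eq_exp_ℂ] at h
  rw [Complex.cosh, ← h]
  ring

theorem cothNum_zero : cothNum ℂ (0 : ℂ) = 0 := by
  have h := cothNum_neg ℂ (0 : ℂ)
  rw [neg_zero] at h
  exact self_eq_neg.mp h

theorem exists_int_of_sinhc_eq_zero {z : ℂ} (h : sinhc ℂ z = 0) :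
    ∃ n : ℤ, n ≠ 0 ∧ z = Complex.I * Real.pi * n := by
  have hz : z ≠ 0 := by
    rintro rfl
    rw [sinhc_zero] at h
    exact one_ne_zero h
  have h1 := mul_sinhc_complex z
  rw [h, mul_zero, Complex.sinh, eq_comm, div_eq_zero_iff, sub_eq_zero] at h1
  obtain ⟨n, hn⟩ := Complex.exp_eq_exp_iff_exists_int.mp (h1.resolve_right two_ne_zero)
  have hn' : z = Complex.I * Real.pi * n := by linear_combination hn / 2
  refine ⟨n, ?_, hn'⟩
  rintro rfl
  exact hz (by simpa using hn')

theorem sinhc_eq_zero_of_int {n : ℤ} (hn : n ≠ 0) : sinhc ℂ (Complex.I * Real.pi * n) = 0 := by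
  have hz : Complex.I * Real.pi * n ≠ 0 := by
    simp [hn, Real.pi_ne_zero]
  have h1 := mul_sinhc_complex (Complex.I * Real.pi * n)
  have h2 : Complex.exp (Complex.I * Real.pi * n) = Complex.exp (-(Complex.I * Real.pi * n)) :=
    Complex.exp_eq_exp_iff_exists_int.mpr ⟨n, by ring⟩
  rw [Complex.sinh, h2, sub_self, zero_div] at h1
  exact (mul_eq_zero.mp h1).resolve_left hz

theorem cothF_mul_sinhc {z : ℂ} (h : sinhc ℂ z ≠ 0) : cothF z * sinhc ℂ z = cothNum ℂ z := by
  by_cases hz : z = 0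
  · rw [hz, cothF, if_pos rfl, zero_mul, cothNum_zero]
  · rw [cothF, if_neg hz, ← sinhc_add_complex, ← mul_sinhc_complex]
    field_simp
    ring

/-! ### Interpolation at the roots of a polynomial -/

section Jets

variable {𝕜 : Type*} [RCLike 𝕜]

/-- The polynomial `q` agrees with `f` at the complex roots of `m`, to the order of the root. -/
def JetAgree (f : ℂ → ℂ) (m q : 𝕜[X]) : Prop :=
  ∀ z : ℂ, ∀ k < (m.map (toComplexHom 𝕜)).rootMultiplicity z,
    (Polynomial.derivative^[k] (q.map (toComplexHom 𝕜))).eval z = iteratedDeriv k f z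

/-- Over `ℂ` the polynomial `m` splits and the difference vanishes at each root to at least the
order of `m`; divisibility then descends to `𝕜`. -/
theorem JetAgree.dvd_sub {f : ℂ → ℂ} {m q₁ q₂ : 𝕜[X]} (hm : m ≠ 0) (h₁ : JetAgree f m q₁)
    (h₂ : JetAgree f m q₂) : m ∣ q₁ - q₂ := by
  by_cases hq : q₁ - q₂ = 0
  · rw [hq]; exact dvd_zero m
  have hD : (q₁ - q₂).map (toComplexHom 𝕜) ≠ 0 :=
    (Polynomial.map_ne_zero_iff (toComplexHom 𝕜).injective).mpr hq
  have hC : m.map (toComplexHom 𝕜) ≠ 0 :=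
    (Polynomial.map_ne_zero_iff (toComplexHom 𝕜).injective).mpr hm
  refine (Polynomial.map_dvd_map' (toComplexHom 𝕜)).mp ?_
  refine (IsAlgClosed.splits (m.map (toComplexHom 𝕜))).dvd_of_roots_le_roots hC ?_
  rw [Multiset.le_iff_count]
  intro z
  rw [Polynomial.count_roots, Polynomial.count_roots]
  by_contra! hlt
  have hkey := Polynomial.lt_rootMultiplicity_of_isRoot_iterate_derivative
    (n := (m.map (toComplexHom 𝕜)).rootMultiplicity z - 1) (t := z) hD (fun k hk => by
      rw [Polynomial.IsRoot, Polynomial.map_sub, Polynomial.iterate_derivative_sub,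
        Polynomial.eval_sub, h₁ z k (by omega), h₂ z k (by omega), sub_self])
  omega

theorem JetAgree.of_dvd {f : ℂ → ℂ} {m m' q : 𝕜[X]} (hm : m ≠ 0) (h : JetAgree f m q)
    (hd : m' ∣ m) : JetAgree f m' q := fun z k hk => by
  have hC : m.map (toComplexHom 𝕜) ≠ 0 :=
    (Polynomial.map_ne_zero_iff (toComplexHom 𝕜).injective).mpr hm
  exact h z k (hk.trans_le
    (Polynomial.rootMultiplicity_le_rootMultiplicity_of_dvd hC (Polynomial.map_dvd _ hd) z))

theorem eval_iterate_derivative_eq_zero_of_dvd {m q : 𝕜[X]} (h : m ∣ q) {z : ℂ} {k : ℕ}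
    (hk : k < (m.map (toComplexHom 𝕜)).rootMultiplicity z) :
    (Polynomial.derivative^[k] (q.map (toComplexHom 𝕜))).eval z = 0 := by
  by_cases hq : q = 0
  · simp [hq]
  have hC : q.map (toComplexHom 𝕜) ≠ 0 :=
    (Polynomial.map_ne_zero_iff (toComplexHom 𝕜).injective).mpr hq
  exact Polynomial.isRoot_iterate_derivative_of_lt_rootMultiplicity (hk.trans_le
    (Polynomial.rootMultiplicity_le_rootMultiplicity_of_dvd hC (Polynomial.map_dvd _ h) z))

theorem toComplexHom_ofReal (x : ℝ) : toComplexHom 𝕜 (x : 𝕜) = x := by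
  simp [toComplexHom]

/-- The truncations of a power series with real coefficients. -/
def truncPoly (𝕜 : Type*) [RCLike 𝕜] (c : ℕ → ℝ) (N : ℕ) : 𝕜[X] :=
  ∑ n ∈ Finset.range N, Polynomial.C (c n : 𝕜) * Polynomial.X ^ n

theorem iteratedDeriv_eval (k : ℕ) (p : ℂ[X]) (z : ℂ) :
    iteratedDeriv k (fun x => p.eval x) z = (Polynomial.derivative^[k] p).eval z := by
  induction k generalizing p with
  | zero => simp
  | succ k ih =>
    rw [iteratedDeriv_succ', Function.iterate_succ_apply, ← ih]
    congr 1
    funext x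
    exact p.deriv

/-- Weierstrass: locally uniform convergence of holomorphic functions passes to all derivatives. -/
theorem tendsto_eval_iterate_derivative_truncPoly {c : ℕ → ℝ} (hc : FactorialBounded c) (k : ℕ)
    (z : ℂ) : Tendsto (fun N => (Polynomial.derivative^[k]
      ((truncPoly 𝕜 c N).map (toComplexHom 𝕜))).eval z) atTop
      (𝓝 (iteratedDeriv k (entireSum ℂ c) z)) := by
  have hp : ∀ N, (truncPoly 𝕜 c N).map (toComplexHom 𝕜) =
      ∑ n ∈ Finset.range N, Polynomial.C (c n : ℂ) * Polynomial.X ^ n := fun N => by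
    simp [truncPoly, Polynomial.map_sum, toComplexHom_ofReal]
  have h0 := (hasFPowerSeriesOnBall_entireSum ℂ (R := ℂ) hc).tendstoLocallyUniformlyOn
  have key : TendstoLocallyUniformlyOn (fun N => iteratedDeriv k (fun x =>
      ((truncPoly 𝕜 c N).map (toComplexHom 𝕜)).eval x)) (iteratedDeriv k (entireSum ℂ c)) atTop
      Set.univ := by
    induction k with
    | zero =>
      simp only [iteratedDeriv_zero]
      simp only [zero_add, Metric.eball_top] at h0
      convert h0 using 3 with N
      simp [hp, FormalMultilinearSeries.partialSum, FormalMultilinearSeries.ofScalars,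
        Polynomial.eval_finsetSum]
    | succ k ih =>
      have h2 := ih.deriv (Eventually.of_forall fun N => ?_) isOpen_univ
      · simpa only [iteratedDeriv_succ, Function.comp_def] using h2
      · have e : iteratedDeriv k (fun x => ((truncPoly 𝕜 c N).map (toComplexHom 𝕜)).eval x) =
            fun x => (Polynomial.derivative^[k]
              ((truncPoly 𝕜 c N).map (toComplexHom 𝕜))).eval x :=
          funext fun x => iteratedDeriv_eval k _ x
        rw [e]
        exact (Polynomial.differentiable _).differentiableOn
  simpa only [iteratedDeriv_eval] using key.tendsto_at (Set.mem_univ z)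

end Jets

end

noncomputable section

open scoped Nat Topology
open Filter

/-! ### Interpolating polynomials for entire functions and for `coth z - 1 / z` -/

section Interpolation

variable {𝕜 : Type*} [RCLike 𝕜]

theorem finite_quotient_span {m : 𝕜[X]} (hm : m ≠ 0) :
    FiniteDimensional 𝕜 (𝕜[X] ⧸ Ideal.span {m}) :=
  (AdjoinRoot.powerBasis hm).finite

theorem aeval_truncPoly {R : Type*} [Ring R] [Algebra 𝕜 R] (c : ℕ → ℝ) (N : ℕ) (T : R) :
    Polynomial.aeval T (truncPoly 𝕜 c N) = ∑ n ∈ Finset.range N, (c n : 𝕜) • T ^ n := by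
  simp [truncPoly, Algebra.smul_def]

theorem continuous_toComplexHom : Continuous (toComplexHom 𝕜) := by
  change Continuous fun z : 𝕜 => (RCLike.re z : ℂ) + (RCLike.im z : ℂ) * Complex.I
  fun_prop

/-- The space of complex numbers as a module over `𝕜`. -/
abbrev complexModule (𝕜 : Type*) [RCLike 𝕜] : Module 𝕜 ℂ := Module.compHom ℂ (toComplexHom 𝕜)

/-- The value of the `k`-th derivative at `z`, as a linear functional on the polynomials modulo a
polynomial which vanishes to a higher order at `z`. -/
theorem exists_jetFunctional {m : 𝕜[X]} {z : ℂ} {k : ℕ}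
    (hk : k < (m.map (toComplexHom 𝕜)).rootMultiplicity z) :
    letI := complexModule 𝕜
    ∃ l : (𝕜[X] ⧸ Ideal.span {m}) →ₗ[𝕜] ℂ, ∀ q : 𝕜[X], l (Ideal.Quotient.mkₐ 𝕜 _ q) =
      (Polynomial.derivative^[k] (q.map (toComplexHom 𝕜))).eval z := by
  let := complexModule 𝕜
  let l₀ : 𝕜[X] →ₗ[𝕜] ℂ :=
    { toFun := fun q => (Polynomial.derivative^[k] (q.map (toComplexHom 𝕜))).eval z
      map_add' := fun p q => by
        rw [Polynomial.map_add, iterate_map_add, Polynomial.eval_add]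
      map_smul' := fun a q => by
        rw [Polynomial.map_smul, Polynomial.iterate_derivative_smul, Polynomial.eval_smul]
        rfl }
  have h0 : ∀ q ∈ (Ideal.span {m}).restrictScalars 𝕜, l₀ q = 0 := fun q hq =>
    eval_iterate_derivative_eq_zero_of_dvd (Ideal.mem_span_singleton.mp hq) hk
  exact ⟨((Ideal.span {m}).restrictScalars 𝕜).liftQ l₀ h0, fun q => rfl⟩

/-- Sum the series at the class of `X` in the finite-dimensional algebra `𝕜[X] / (m)` and lift the
sum to `s`. Jets at roots of `m` are continuous functionals on this quotient, so those of `s` are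
limits of those of the truncations. This produces coefficients in `𝕜` even for `𝕜 = ℝ`. The
convergence is recorded for the next lemma. -/
theorem exists_jetAgree_entireSum {c : ℕ → ℝ} (hc : FactorialBounded c) {m : 𝕜[X]} (hm : m ≠ 0) :
    ∃ s : 𝕜[X], JetAgree (entireSum ℂ c) m s ∧
      have := finite_quotient_span hm
      letI : NormedRing (𝕜[X] ⧸ Ideal.span {m}) := leftRegularNormedRing 𝕜 _
      Tendsto (fun N => Ideal.Quotient.mkₐ 𝕜 (Ideal.span {m}) (truncPoly 𝕜 c N)) atTop
        (𝓝 (Ideal.Quotient.mkₐ 𝕜 (Ideal.span {m}) s)) := by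
  have := finite_quotient_span hm
  let : NormedRing (𝕜[X] ⧸ Ideal.span {m}) := leftRegularNormedRing 𝕜 _
  let : NormedAlgebra 𝕜 (𝕜[X] ⧸ Ideal.span {m}) := leftRegularNormedAlgebra 𝕜 _
  have := FiniteDimensional.complete 𝕜 (𝕜[X] ⧸ Ideal.span {m})
  let π : 𝕜[X] →ₐ[𝕜] 𝕜[X] ⧸ Ideal.span {m} := Ideal.Quotient.mkₐ 𝕜 _
  obtain ⟨s, hs⟩ := Ideal.Quotient.mkₐ_surjective 𝕜 (Ideal.span {m})
    (entireSum 𝕜 c (π Polynomial.X))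
  have ht : Tendsto (fun N => π (truncPoly 𝕜 c N)) atTop (𝓝 (π s)) := by
    have h1 := (hasSum_entireSum 𝕜 hc (π Polynomial.X)).tendsto_sum_nat
    rw [← hs] at h1
    refine h1.congr fun N => ?_
    rw [← aeval_truncPoly, Polynomial.aeval_algHom_apply, Polynomial.aeval_X_left, AlgHom.id_apply]
  refine ⟨s, fun z k hk => ?_, ht⟩
  let := complexModule 𝕜
  have : ContinuousSMul 𝕜 ℂ := ⟨by
    change Continuous fun p : 𝕜 × ℂ => toComplexHom 𝕜 p.1 * p.2
    exact (continuous_toComplexHom.comp continuous_fst).mul continuous_snd⟩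
  obtain ⟨l, hl⟩ := exists_jetFunctional hk
  have h2 := (l.continuous_of_finiteDimensional.tendsto _).comp ht
  simp only [Function.comp_def, π, hl] at h2
  exact tendsto_nhds_unique h2 (tendsto_eval_iterate_derivative_truncPoly hc k z)

/-- Evaluation at `T` factors through `𝕜[X] / (m)`, where it is continuous, so the limit of the
truncations may be taken before evaluating. -/
theorem entireSum_eq_aeval {c : ℕ → ℝ} (hc : FactorialBounded c) {m s : 𝕜[X]} (hm : m ≠ 0)
    (hs : JetAgree (entireSum ℂ c) m s) {R : Type*} [NormedRing R] [NormedAlgebra 𝕜 R]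
    [CompleteSpace R] {T : R} (hT : Polynomial.aeval T m = 0) :
    entireSum 𝕜 c T = Polynomial.aeval T s := by
  obtain ⟨s', hs', ht⟩ := exists_jetAgree_entireSum hc hm
  have := finite_quotient_span hm
  let : NormedRing (𝕜[X] ⧸ Ideal.span {m}) := leftRegularNormedRing 𝕜 _
  let : NormedAlgebra 𝕜 (𝕜[X] ⧸ Ideal.span {m}) := leftRegularNormedAlgebra 𝕜 _
  have h0 : ∀ q ∈ Ideal.span {m}, Polynomial.aeval T q = 0 := fun q hq => by
    obtain ⟨r, rfl⟩ := Ideal.mem_span_singleton.mp hq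
    rw [map_mul, hT, zero_mul]
  let f : (𝕜[X] ⧸ Ideal.span {m}) →ₐ[𝕜] R :=
    Ideal.Quotient.liftₐ (Ideal.span {m}) (Polynomial.aeval T) h0
  have h1 := (f.toLinearMap.continuous_of_finiteDimensional.tendsto _).comp ht
  have h2 : Tendsto (fun N => Polynomial.aeval T (truncPoly 𝕜 c N)) atTop
      (𝓝 (Polynomial.aeval T s')) := h1
  have h3 := (hasSum_entireSum 𝕜 hc T).tendsto_sum_nat
  simp only [← aeval_truncPoly] at h3
  obtain ⟨r, hr⟩ := hs.dvd_sub hm hs'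
  have h4 : Polynomial.aeval T (s - s') = 0 := by rw [hr, map_mul, hT, zero_mul]
  rw [map_sub, sub_eq_zero] at h4
  rw [h4]
  exact tendsto_nhds_unique h3 h2

/-- No pole of `cothF` is a root of `m`. -/
def AvoidsPoles (m : 𝕜[X]) : Prop :=
  ∀ n : ℤ, n ≠ 0 → ¬ (m.map (toComplexHom 𝕜)).IsRoot (Complex.I * Real.pi * n)

theorem AvoidsPoles.mul {m m' : 𝕜[X]} (h : AvoidsPoles m) (h' : AvoidsPoles m') :
    AvoidsPoles (m * m') := fun n hn => by
  rw [Polynomial.map_mul, Polynomial.IsRoot, Polynomial.eval_mul, mul_eq_zero, not_or]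
  exact ⟨h n hn, h' n hn⟩

theorem AvoidsPoles.comp_neg {m : 𝕜[X]} (h : AvoidsPoles m) :
    AvoidsPoles (m.comp (-Polynomial.X)) := fun n hn h0 => by
  refine h (-n) (neg_ne_zero.mpr hn) ?_
  rw [Polynomial.IsRoot, Polynomial.map_comp, Polynomial.eval_comp] at h0
  rw [Polynomial.IsRoot, ← h0]
  simp

theorem AvoidsPoles.sinhc_ne_zero {m : 𝕜[X]} (h : AvoidsPoles m) {z : ℂ}
    (hz : (m.map (toComplexHom 𝕜)).IsRoot z) : sinhc ℂ z ≠ 0 := fun h0 => by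
  obtain ⟨n, hn, rfl⟩ := exists_int_of_sinhc_eq_zero h0
  exact h n hn hz

theorem isCoprime_of_forall_root {p q : 𝕜[X]} (h : ∀ z : ℂ, (q.map (toComplexHom 𝕜)).IsRoot z →
    (p.map (toComplexHom 𝕜)).eval z ≠ 0) : IsCoprime p q := by
  rw [← Polynomial.isCoprime_map (toComplexHom 𝕜),
    Polynomial.isCoprime_iff_aeval_ne_zero_of_isAlgClosed (k := ℂ) ℂ]
  intro z
  rw [or_iff_not_imp_right, not_not]
  intro hz
  simpa using h z (by simpa using hz)

theorem JetAgree.eval_eq {f : ℂ → ℂ} {m q : 𝕜[X]} (hm : m ≠ 0) (h : JetAgree f m q) {z : ℂ}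
    (hz : (m.map (toComplexHom 𝕜)).IsRoot z) : (q.map (toComplexHom 𝕜)).eval z = f z := by
  have hC : m.map (toComplexHom 𝕜) ≠ 0 :=
    (Polynomial.map_ne_zero_iff (toComplexHom 𝕜).injective).mpr hm
  simpa using h z 0 ((Polynomial.rootMultiplicity_pos hC).mpr hz)

/-- A quotient of jets is computed by division modulo `m`. -/
theorem JetAgree.of_mul {f s h : ℂ → ℂ} {m ps ph q : 𝕜[X]} (hs : JetAgree s m ps)
    (hh : JetAgree h m ph) (hd : m ∣ ps * q - ph)
    (hsc : ContDiff ℂ ∞ s) (hhc : ContDiff ℂ ∞ h)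
    (hf : ∀ z, s z ≠ 0 → f z * s z = h z)
    (h0 : ∀ z, (m.map (toComplexHom 𝕜)).IsRoot z → s z ≠ 0) : JetAgree f m q := by
  intro z k
  -- Compare the Leibniz expansions of `f * s = h` and of `ps * q ≡ ph`. By induction all terms
  -- agree except the one with the `k`-th derivative of `f` or `q`, whose factor `s z ≠ 0` cancels.
  induction k using Nat.strong_induction_on with
  | _ k ih =>
    intro hk
    have hz : s z ≠ 0 := h0 z (Polynomial.rootMultiplicity_pos'.mp (by omega)).2
    have hev : ∀ᶠ w in 𝓝 z, s w ≠ 0 := hsc.continuous.continuousAt.eventually_ne hz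
    have hfe : (fun w => f w * s w) =ᶠ[𝓝 z] h := hev.mono fun w hw => hf w hw
    have hfc : ContDiffAt ℂ ∞ f z := by
      refine (hhc.contDiffAt.div hsc.contDiffAt hz).congr_of_eventuallyEq ?_
      filter_upwards [hev] with w hw
      rw [Pi.div_apply, eq_div_iff hw, hf w hw]
    have hle : ∀ j : ℕ, (j : WithTop ℕ∞) ≤ ∞ := fun j => by exact_mod_cast le_top
    have e1 := hfe.iteratedDeriv_eq k
    have e2 := iteratedDeriv_mul (n := k) (hfc.of_le (hle k)) ((hsc.contDiffAt (x := z)).of_le (hle k))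
    have e3 := eval_iterate_derivative_eq_zero_of_dvd hd hk
    rw [Polynomial.map_sub, Polynomial.iterate_derivative_sub, Polynomial.eval_sub, hh z k hk,
      sub_eq_zero, Polynomial.map_mul, Polynomial.iterate_derivative_mul,
      Polynomial.eval_finsetSum, ← e1] at e3
    replace e3 := e3.trans e2
    rw [Nat.succ_eq_add_one, Finset.sum_range_succ, Finset.sum_range_succ] at e3
    have e4 : ∀ i ∈ Finset.range k, ((k.choose i) • (Polynomial.derivative^[k - i]
        (ps.map (toComplexHom 𝕜)) * Polynomial.derivative^[i] (q.map (toComplexHom 𝕜)))).eval z =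
        k.choose i * iteratedDeriv i f z * iteratedDeriv (k - i) s z := fun i hi => by
      have hi' := Finset.mem_range.mp hi
      rw [Polynomial.eval_smul, Polynomial.eval_mul, hs z (k - i) (by omega),
        ih i hi' (hi'.trans hk), nsmul_eq_mul]
      ring
    rw [Finset.sum_congr rfl e4, add_right_inj, Polynomial.eval_smul, Polynomial.eval_mul,
      Nat.sub_self, hs z 0 (by omega), Nat.choose_self, one_smul, iteratedDeriv_zero,
      Nat.cast_one, one_mul, mul_comm] at e3
    exact mul_right_cancel₀ hz e3

theorem exists_isCoprime_sinhc {m ps : 𝕜[X]} (hm : m ≠ 0) (hp : AvoidsPoles m)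
    (hs : JetAgree (entireSum ℂ sinhcCoeff) m ps) : IsCoprime ps m :=
  isCoprime_of_forall_root fun z hz => by
    rw [hs.eval_eq hm hz]
    exact hp.sinhc_ne_zero hz

theorem jetAgree_cothF_of_dvd {m ps ph q : 𝕜[X]} (hp : AvoidsPoles m)
    (hs : JetAgree (entireSum ℂ sinhcCoeff) m ps) (hh : JetAgree (entireSum ℂ cothNumCoeff) m ph)
    (hd : m ∣ ps * q - ph) : JetAgree cothF m q :=
  JetAgree.of_mul hs hh hd (contDiff_entireSum ℂ factorialBounded_sinhcCoeff)
    (contDiff_entireSum ℂ factorialBounded_cothNumCoeff) (fun _ h => cothF_mul_sinhc h)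
    (fun _ hz => hp.sinhc_ne_zero hz)

theorem exists_jetAgree_cothF {m : 𝕜[X]} (hm : m ≠ 0) (hp : AvoidsPoles m) :
    ∃ ps ph q : 𝕜[X], JetAgree (entireSum ℂ sinhcCoeff) m ps ∧
      JetAgree (entireSum ℂ cothNumCoeff) m ph ∧ m ∣ ps * q - ph ∧ JetAgree cothF m q := by
  obtain ⟨ps, hs, -⟩ := exists_jetAgree_entireSum factorialBounded_sinhcCoeff hm
  obtain ⟨ph, hh, -⟩ := exists_jetAgree_entireSum factorialBounded_cothNumCoeff hm
  -- Bézout: `u` inverts the denominator modulo `m`, so `u * ph` represents the quotient.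
  obtain ⟨u, v, huv⟩ := exists_isCoprime_sinhc hm hp hs
  have hd : m ∣ ps * (u * ph) - ph := ⟨-v * ph, by linear_combination ph * huv⟩
  exact ⟨ps, ph, u * ph, hs, hh, hd, jetAgree_cothF_of_dvd hp hs hh hd⟩

section Banach

variable {R : Type*} [NormedRing R] [NormedAlgebra 𝕜 R] [CompleteSpace R]

theorem isUnit_sinhc_of_aeval_eq_zero {m : 𝕜[X]} (hm : m ≠ 0) (hp : AvoidsPoles m) {T : R}
    (hT : Polynomial.aeval T m = 0) : IsUnit (sinhc 𝕜 T) := by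
  obtain ⟨ps, hs, -⟩ := exists_jetAgree_entireSum factorialBounded_sinhcCoeff hm
  obtain ⟨u, v, huv⟩ := exists_isCoprime_sinhc hm hp hs
  have h1 := congrArg (Polynomial.aeval T) huv
  rw [map_add, map_mul, map_mul, hT, mul_zero, add_zero, map_one] at h1
  rw [sinhc, entireSum_eq_aeval factorialBounded_sinhcCoeff hm hs hT]
  refine ⟨⟨Polynomial.aeval T ps, Polynomial.aeval T u, ?_, h1⟩, rfl⟩
  rw [← map_mul, mul_comm, map_mul, h1]

/-- The bridge between the two forms of `F(T)`. The same `q` serves every element killed by `m`, in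
every Banach algebra. -/
theorem cothSub_eq_aeval {m q : 𝕜[X]} (hm : m ≠ 0) (hp : AvoidsPoles m) (hq : JetAgree cothF m q)
    {T : R} (hT : Polynomial.aeval T m = 0) : cothSub 𝕜 T = Polynomial.aeval T q := by
  obtain ⟨ps, ph, q', hs, hh, ⟨r, hr⟩, hq'⟩ := exists_jetAgree_cothF hm hp
  obtain ⟨r', hr'⟩ := hq.dvd_sub hm hq'
  have h1 := congrArg (Polynomial.aeval T) hr
  have h2 := congrArg (Polynomial.aeval T) hr'
  rw [map_mul _ m, hT, zero_mul, map_sub, sub_eq_zero] at h1 h2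
  rw [h2]
  refine cothSub_eq_of_sinhc_mul_eq 𝕜 (isUnit_sinhc_of_aeval_eq_zero hm hp hT) ?_
  rw [sinhc, cothNum, entireSum_eq_aeval factorialBounded_sinhcCoeff hm hs hT,
    entireSum_eq_aeval factorialBounded_cothNumCoeff hm hh hT, ← h1, map_mul]

end Banach

/-! ### Poles in the spectrum and invertibility of `sinhc T` -/

section Spectrum

variable {V : Type*} [AddCommGroup V] [Module 𝕜 V] [FiniteDimensional 𝕜 V]

/-- The complex eigenvalues are roots of every annihilating polynomial. -/
theorem eval_eq_zero_of_mem_complexSpectrum {T : Module.End 𝕜 V} {z : ℂ}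
    (hz : z ∈ complexSpectrum T) {p : 𝕜[X]} (hp : Polynomial.aeval T p = 0) :
    (p.map (toComplexHom 𝕜)).eval z = 0 := by
  let : Algebra 𝕜 ℂ := (toComplexHom 𝕜).toAlgebra
  have h1 : (LinearMap.baseChange ℂ T).charpoly.IsRoot z := by
    rw [LinearMap.charpoly_baseChange]
    exact hz
  obtain ⟨v, hv⟩ := ((Module.End.hasEigenvalue_iff_isRoot_charpoly _ _).mpr h1).exists_hasEigenvector
  have h2 := Module.End.aeval_apply_of_hasEigenvector (p := p.map (algebraMap 𝕜 ℂ)) hv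
  have h3 : Polynomial.aeval (LinearMap.baseChange ℂ T) p =
      LinearMap.baseChange ℂ (Polynomial.aeval T p) :=
    Polynomial.aeval_algHom_apply (Module.End.baseChangeHom 𝕜 ℂ V) T p
  rw [Polynomial.aeval_map_algebraMap, h3, hp] at h2
  rw [LinearMap.baseChange_zero, LinearMap.zero_apply, eq_comm, smul_eq_zero] at h2
  exact h2.resolve_right hv.2

theorem avoidsPoles_charpoly_of_isUnit {T : Module.End 𝕜 V}
    (h : letI := leftRegularNormedRing 𝕜 (Module.End 𝕜 V); IsUnit (sinhc 𝕜 T)) :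
    AvoidsPoles T.charpoly := by
  intro n hn hz
  let := leftRegularNormedRing 𝕜 (Module.End 𝕜 V)
  let := leftRegularNormedAlgebra 𝕜 (Module.End 𝕜 V)
  have := FiniteDimensional.complete 𝕜 (Module.End 𝕜 V)
  have hm := T.charpoly_monic.ne_zero
  obtain ⟨ps, hs, -⟩ := exists_jetAgree_entireSum factorialBounded_sinhcCoeff hm
  have h1 : sinhc 𝕜 T = Polynomial.aeval T ps :=
    entireSum_eq_aeval factorialBounded_sinhcCoeff hm hs T.aeval_self_charpoly
  have h0 : (ps.map (toComplexHom 𝕜)).eval (Complex.I * Real.pi * n) = 0 := by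
    rw [hs.eval_eq hm hz]
    exact sinhc_eq_zero_of_int hn
  rw [h1] at h
  -- The characteristic polynomial of `ps(T)`, composed with `ps`, kills `T`. At the pole, where
  -- `ps` vanishes, its value is the constant coefficient, which is the determinant of `ps(T)` up to
  -- sign.
  have h2 := eval_eq_zero_of_mem_complexSpectrum
    (p := (Polynomial.aeval T ps : Module.End 𝕜 V).charpoly.comp ps) hz (by
      rw [Polynomial.aeval_comp, LinearMap.aeval_self_charpoly])
  rw [Polynomial.map_comp, Polynomial.eval_comp, h0, ← Polynomial.coeff_zero_eq_eval_zero,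
    Polynomial.coeff_map, map_eq_zero] at h2
  have h3 := LinearMap.det_eq_sign_charpoly_coeff (Polynomial.aeval T ps : Module.End 𝕜 V)
  rw [h2, mul_zero] at h3
  exact (h.map LinearMap.det).ne_zero h3

end Spectrum

end Interpolation
end

noncomputable section

open scoped Nat Topology
open Filter

/-! ### The functional equation of `coth z - 1 / z` in commutative algebras -/

section FunctionalEquation

attribute [local instance] Matrix.linftyOpNormedRing Matrix.linftyOpNormedAlgebra completeSpace_block

variable (𝕜 : Type*) [RCLike 𝕜]

/-- The shift can fail to be invertible only when `-(k * e)` is one of the finitely many roots of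
the minimal polynomial of `a`. -/
theorem eventually_isUnit_add_algebraMap {R : Type*} [CommRing R] [Algebra 𝕜 R]
    [FiniteDimensional 𝕜 R] (a : R) {k : 𝕜} (hk : k ≠ 0) :
    ∀ᶠ e : 𝕜 in 𝓝[≠] 0, IsUnit (a + algebraMap 𝕜 R (k * e)) := by
  have hp : minpoly 𝕜 a ≠ 0 := minpoly.ne_zero (Algebra.IsIntegral.isIntegral a)
  have hfin : {e : 𝕜 | (minpoly 𝕜 a).IsRoot (-(k * e))}.Finite :=
    (Polynomial.finite_setOfPred_isRoot hp).preimage fun x _ y _ h => mul_left_cancel₀ hk (neg_injective h)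
  filter_upwards [(nhdsNE_le_cofinite (0 : 𝕜)) hfin.compl_mem_cofinite] with e he
  obtain ⟨q, hq⟩ := Polynomial.X_sub_C_dvd_sub_C_eval (p := minpoly 𝕜 a) (a := -(k * e))
  have h1 := congrArg (Polynomial.aeval a) hq
  rw [map_sub, minpoly.aeval, zero_sub, map_mul, map_sub, Polynomial.aeval_X, Polynomial.aeval_C,
    Polynomial.aeval_C, map_neg, sub_neg_eq_add] at h1
  refine isUnit_of_mul_isUnit_left (y := Polynomial.aeval a q) ?_
  rw [← h1]
  exact ((isUnit_iff_ne_zero.mpr he).map (algebraMap 𝕜 R)).neg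

variable {R : Type*} [NormedCommRing R] [NormedAlgebra 𝕜 R]

section Complete

variable [CompleteSpace R]

/-- The divided difference of `F = coth z - 1 / z` at `x` and `y`. -/
def cothDivDiff (x y : R) : R := cothSub 𝕜 !![x, 1; 0, y] 0 1

/-- Here `b - (-c) = -a` is invertible, so `-a'` solves the Sylvester equation; `F(-c) = -F(c)` by
oddness. -/
theorem cothDivDiff_eq {a b c a' : R} (ha : a * a' = 1) (h : a + b + c = 0)
    (hb : IsUnit (sinhc 𝕜 b)) (hc : IsUnit (sinhc 𝕜 c)) :
    cothDivDiff 𝕜 (-c) b = -a' * (cothSub 𝕜 b + cothSub 𝕜 c) := by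
  have hc' : IsUnit (sinhc 𝕜 (-c)) := by rwa [sinhc_neg]
  rw [cothDivDiff, cothSub_block 𝕜 (t := -a') hc' hb (by linear_combination ha - a' * h),
    cothSub_neg]
  simp
  ring

theorem two_mul_mul_sinhc_mul_cothSub {a : R} (ha : IsUnit (sinhc 𝕜 a)) :
    (a * cothSub 𝕜 a + 1) * (NormedSpace.exp a - NormedSpace.exp (-a)) =
      a * (NormedSpace.exp a + NormedSpace.exp (-a)) := by
  rw [← two_mul_mul_sinhc 𝕜, ← two_mul_sinhc_add 𝕜, ← sinhc_mul_cothSub 𝕜 ha]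
  ring

/-- In terms of `F(x) + 1/x = coth x`, the left side is minus the cyclic sum of the products `coth a
coth b`, plus `1/(ab) + 1/(bc) + 1/(ca)`. The first part is `1` by the addition theorem, and the
second is `(a + b + c)/(abc) = 0`. -/
theorem cothSub_functional_equation_of_mul_eq_one {a b c a' b' c' : R} (haa : a * a' = 1)
    (hbb : b * b' = 1) (hcc : c * c' = 1) (h : a + b + c = 0) (ha : IsUnit (sinhc 𝕜 a))
    (hb : IsUnit (sinhc 𝕜 b)) (hc : IsUnit (sinhc 𝕜 c)) :
    cothDivDiff 𝕜 (-c) b + cothDivDiff 𝕜 (-a) c + cothDivDiff 𝕜 (-b) a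
      - (cothSub 𝕜 a * cothSub 𝕜 b + cothSub 𝕜 b * cothSub 𝕜 c + cothSub 𝕜 c * cothSub 𝕜 a)
      = 1 := by
  have h2 : IsUnit (2 : R) := by
    have := (isUnit_iff_ne_zero.mpr (two_ne_zero (α := 𝕜))).map (algebraMap 𝕜 R)
    rwa [map_ofNat] at this
  rw [cothDivDiff_eq 𝕜 haa h hb hc, cothDivDiff_eq 𝕜 hbb (by rw [← h]; ring) hc ha,
    cothDivDiff_eq 𝕜 hcc (by rw [← h]; ring) ha hb]
  have key : ∀ {x x' : R}, x * x' = 1 → IsUnit (sinhc 𝕜 x) →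
      IsUnit (NormedSpace.exp x - NormedSpace.exp (-x)) ∧
      (cothSub 𝕜 x + x') * (NormedSpace.exp x - NormedSpace.exp (-x)) =
        NormedSpace.exp x + NormedSpace.exp (-x) := by
    intro x x' hxx hx
    constructor
    · rw [← two_mul_mul_sinhc 𝕜]
      exact h2.mul ((IsUnit.of_mul_eq_one _ hxx).mul hx)
    · have e := two_mul_mul_sinhc_mul_cothSub 𝕜 hx
      linear_combination x' * e + (NormedSpace.exp x + NormedSpace.exp (-x) -
        cothSub 𝕜 x * (NormedSpace.exp x - NormedSpace.exp (-x))) * hxx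
  obtain ⟨hua, hka⟩ := key haa ha
  obtain ⟨hub, hkb⟩ := key hbb hb
  obtain ⟨huc, hkc⟩ := key hcc hc
  let := NormedAlgebra.restrictScalars ℚ 𝕜 R
  have e1 : NormedSpace.exp a * NormedSpace.exp b * NormedSpace.exp c = 1 := by
    rw [← NormedSpace.exp_add, ← NormedSpace.exp_add, h, NormedSpace.exp_zero]
  have e2 : NormedSpace.exp (-a) * NormedSpace.exp (-b) * NormedSpace.exp (-c) = 1 := by
    rw [← NormedSpace.exp_add, ← NormedSpace.exp_add,
      show -a + -b + -c = 0 by linear_combination -h, NormedSpace.exp_zero]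
  set A := NormedSpace.exp a
  set A' := NormedSpace.exp (-a)
  set B := NormedSpace.exp b
  set B' := NormedSpace.exp (-b)
  set C := NormedSpace.exp c
  set C' := NormedSpace.exp (-c)
  set x := cothSub 𝕜 a
  set y := cothSub 𝕜 b
  set z := cothSub 𝕜 c
  have hk : (x + a') * (y + b') + (y + b') * (z + c') + (z + c') * (x + a') = -1 := by
    refine ((hua.mul hub).mul huc).mul_left_injective ?_
    change _ * ((A - A') * (B - B') * (C - C')) = -1 * ((A - A') * (B - B') * (C - C'))
    -- The addition theorem without denominators: the mixed monomials cancel and `4ABC - 4A'B'C'`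
    -- remains.
    have e3 : (A + A') * (B + B') * (C - C') + (B + B') * (C + C') * (A - A')
        + (C + C') * (A + A') * (B - B') + (A - A') * (B - B') * (C - C') = 0 := by
      linear_combination 4 * e1 - 4 * e2
    linear_combination e3
      + (C - C') * ((y + b') * (B - B')) * hka + (C - C') * (A + A') * hkb
      + (A - A') * ((z + c') * (C - C')) * hkb + (A - A') * (B + B') * hkc
      + (B - B') * ((x + a') * (A - A')) * hkc + (B - B') * (C + C') * hka
  have hz : a' * b' + b' * c' + c' * a' = 0 := by
    linear_combination a' * b' * c' * h - b' * c' * haa - a' * c' * hbb - a' * b' * hcc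
  linear_combination -hk + hz

end Complete

theorem tendsto_cothDivDiff [CompleteSpace R] {x y : R}
    (hB : IsUnit (sinhc 𝕜 (!![x, 1; 0, y] : Matrix (Fin 2) (Fin 2) R))) {f g : 𝕜 → R}
    (hf : Continuous f) (hg : Continuous g) (hf0 : f 0 = x) (hg0 : g 0 = y) :
    Tendsto (fun e => cothDivDiff 𝕜 (f e) (g e)) (𝓝[≠] 0) (𝓝 (cothDivDiff 𝕜 x y)) := by
  have hc : Continuous fun s : 𝕜 => (!![f s, 1; 0, g s] : Matrix (Fin 2) (Fin 2) R) :=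
    continuous_block hf continuous_const hg
  have hF : ContinuousAt (cothSub 𝕜) (!![f 0, 1; 0, g 0] : Matrix (Fin 2) (Fin 2) R) := by
    rw [hf0, hg0]; exact (contDiffAt_cothSub 𝕜 hB).continuousAt
  have h1 := (hF.comp (f := fun s : 𝕜 => (!![f s, 1; 0, g s] : Matrix (Fin 2) (Fin 2) R))
    hc.continuousAt).tendsto
  have h3 : Continuous fun M : Matrix (Fin 2) (Fin 2) R => M 0 1 := continuous_id.matrix_elem 0 1
  have h4 := (h3.tendsto _).comp h1
  simp only [Function.comp_def, hf0, hg0] at h4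
  exact h4.mono_left nhdsWithin_le_nhds

/-- For `a + b + c = 0`, the sum of the divided differences of `F = coth z - 1 / z` minus the sum of
its products is equal to `1`. -/
theorem cothSub_functional_equation [FiniteDimensional 𝕜 R] {a b c : R} (h : a + b + c = 0)
    (ha : IsUnit (sinhc 𝕜 a)) (hb : IsUnit (sinhc 𝕜 b)) (hc : IsUnit (sinhc 𝕜 c))
    (hcb : IsUnit (sinhc 𝕜 (!![-c, 1; 0, b] : Matrix (Fin 2) (Fin 2) R)))
    (hac : IsUnit (sinhc 𝕜 (!![-a, 1; 0, c] : Matrix (Fin 2) (Fin 2) R)))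
    (hba : IsUnit (sinhc 𝕜 (!![-b, 1; 0, a] : Matrix (Fin 2) (Fin 2) R))) :
    cothDivDiff 𝕜 (-c) b + cothDivDiff 𝕜 (-a) c + cothDivDiff 𝕜 (-b) a
      - (cothSub 𝕜 a * cothSub 𝕜 b + cothSub 𝕜 b * cothSub 𝕜 c + cothSub 𝕜 c * cothSub 𝕜 a)
      = 1 := by
  have := FiniteDimensional.complete 𝕜 R
  -- The weights `1, 1, -2` are nonzero with sum zero: the relation `a + b + c = 0` persists while
  -- all three elements become invertible for small `e ≠ 0`. Both sides are continuous at `e = 0`.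
  let A : 𝕜 → R := fun e => a + algebraMap 𝕜 R (1 * e)
  let B : 𝕜 → R := fun e => b + algebraMap 𝕜 R (1 * e)
  let C : 𝕜 → R := fun e => c + algebraMap 𝕜 R (-2 * e)
  have hA : Continuous A := by fun_prop
  have hB : Continuous B := by fun_prop
  have hC : Continuous C := by fun_prop
  have hA0 : A 0 = a := by simp [A]
  have hB0 : B 0 = b := by simp [B]
  have hC0 : C 0 = c := by simp [C]
  have hF : ∀ {x : R} {f : 𝕜 → R}, IsUnit (sinhc 𝕜 x) → Continuous f → f 0 = x →
      Tendsto (fun e => cothSub 𝕜 (f e)) (𝓝[≠] 0) (𝓝 (cothSub 𝕜 x)) := by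
    intro x f hx hf hf0
    have h1 := (contDiffAt_cothSub 𝕜 hx).continuousAt.tendsto
    rw [← hf0] at h1
    rw [← hf0]
    exact (h1.comp hf.continuousAt).mono_left nhdsWithin_le_nhds
  have hU : ∀ {x : R} {f : 𝕜 → R}, IsUnit (sinhc 𝕜 x) → Continuous f → f 0 = x →
      ∀ᶠ e in 𝓝[≠] 0, IsUnit (sinhc 𝕜 (f e)) := by
    intro x f hx hf hf0
    refine (hf.continuousAt.eventually_mem ((isOpen_isUnit_sinhc 𝕜).mem_nhds ?_)).filter_mono
      nhdsWithin_le_nhds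
    rwa [hf0]
  have ht := (((tendsto_cothDivDiff 𝕜 hcb hC.neg hB (by simp [hC0]) hB0).add
    (tendsto_cothDivDiff 𝕜 hac hA.neg hC (by simp [hA0]) hC0)).add
    (tendsto_cothDivDiff 𝕜 hba hB.neg hA (by simp [hB0]) hA0)).sub
    ((((hF ha hA hA0).mul (hF hb hB hB0)).add ((hF hb hB hB0).mul (hF hc hC hC0))).add
      ((hF hc hC hC0).mul (hF ha hA hA0)))
  refine tendsto_nhds_unique (ht.congr' ?_) tendsto_const_nhds
  filter_upwards [eventually_isUnit_add_algebraMap 𝕜 a one_ne_zero,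
    eventually_isUnit_add_algebraMap 𝕜 b one_ne_zero,
    eventually_isUnit_add_algebraMap 𝕜 c (neg_ne_zero.mpr two_ne_zero), hU ha hA hA0, hU hb hB hB0,
    hU hc hC hC0] with e h1 h2 h3 h4 h5 h6
  obtain ⟨a', ha'⟩ := h1.exists_right_inv
  obtain ⟨b', hb'⟩ := h2.exists_right_inv
  obtain ⟨c', hc'⟩ := h3.exists_right_inv
  refine cothSub_functional_equation_of_mul_eq_one 𝕜 ha' hb' hc' ?_ h4 h5 h6
  simp only [A, B, C, map_mul, map_neg, map_ofNat, map_one]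
  linear_combination h

end FunctionalEquation
end

noncomputable section

open scoped Nat Topology
open Filter
open scoped IsMulCommutative

/-! ### The functional equation for commuting endomorphisms -/

section Trilinear

attribute [local instance] Matrix.linftyOpNormedRing Matrix.linftyOpNormedAlgebra completeSpace_block

variable {𝕜 : Type*} [RCLike 𝕜]

/-- The divided difference of the polynomial `q` at `x` and `y`. -/
def polyDivDiff {R : Type*} [Ring R] [Algebra 𝕜 R] (q : 𝕜[X]) (x y : R) : R :=
  Polynomial.aeval (!![x, 1; 0, y] : Matrix (Fin 2) (Fin 2) R) q 0 1

theorem map_polyDivDiff {R R' : Type*} [Ring R] [Algebra 𝕜 R] [Ring R'] [Algebra 𝕜 R']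
    (f : R →ₐ[𝕜] R') (q : 𝕜[X]) (x y : R) :
    f (polyDivDiff q x y) = polyDivDiff q (f x) (f y) := by
  have h := Polynomial.aeval_algHom_apply f.mapMatrix (!![x, 1; 0, y] : Matrix (Fin 2) (Fin 2) R) q
  have e : f.mapMatrix (!![x, 1; 0, y] : Matrix (Fin 2) (Fin 2) R) = !![f x, 1; 0, f y] := by
    ext i j; fin_cases i <;> fin_cases j <;> simp
  rw [e] at h
  rw [polyDivDiff, polyDivDiff, h]
  rfl

/-- With `q` in place of `F` the identity is purely algebraic, so the auxiliary norm on `R`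
disappears from the statement and the identity can be moved along homomorphisms. -/
theorem polyDivDiff_functional_equation {m q : 𝕜[X]} (hm : m ≠ 0) (hp : AvoidsPoles m)
    (hq : JetAgree cothF (m ^ 2) q) {R : Type*} [CommRing R] [Algebra 𝕜 R] [FiniteDimensional 𝕜 R]
    {a b c : R} (h : a + b + c = 0) (ha : Polynomial.aeval a m = 0)
    (hb : Polynomial.aeval b m = 0) (hc : Polynomial.aeval c m = 0)
    (ha' : Polynomial.aeval (-a) m = 0) (hb' : Polynomial.aeval (-b) m = 0)
    (hc' : Polynomial.aeval (-c) m = 0) :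
    polyDivDiff q (-c) b + polyDivDiff q (-a) c + polyDivDiff q (-b) a
      - (Polynomial.aeval a q * Polynomial.aeval b q + Polynomial.aeval b q * Polynomial.aeval c q
        + Polynomial.aeval c q * Polynomial.aeval a q) = 1 := by
  let : NormedCommRing R := { leftRegularNormedRing 𝕜 R with mul_comm := mul_comm }
  let : NormedAlgebra 𝕜 R := leftRegularNormedAlgebra 𝕜 R
  have := FiniteDimensional.complete 𝕜 R
  have hm2 : m ^ 2 ≠ 0 := pow_ne_zero 2 hm
  have hp2 : AvoidsPoles (m ^ 2) := by rw [pow_two]; exact hp.mul hp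
  have hu : ∀ {x : R}, Polynomial.aeval x m = 0 → IsUnit (sinhc 𝕜 x) := fun hx =>
    isUnit_sinhc_of_aeval_eq_zero hm hp hx
  have hs : ∀ {x : R}, Polynomial.aeval x m = 0 → cothSub 𝕜 x = Polynomial.aeval x q := fun hx =>
    cothSub_eq_aeval hm hp (hq.of_dvd hm2 (dvd_pow_self m two_ne_zero)) hx
  have hub : ∀ {x y : R}, Polynomial.aeval x m = 0 → Polynomial.aeval y m = 0 →
      IsUnit (sinhc 𝕜 (!![x, 1; 0, y] : Matrix (Fin 2) (Fin 2) R)) := fun hx hy =>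
    isUnit_sinhc_of_aeval_eq_zero hm2 hp2 (aeval_block_sq 𝕜 1 hx hy)
  have hsb : ∀ {x y : R}, Polynomial.aeval x m = 0 → Polynomial.aeval y m = 0 →
      cothDivDiff 𝕜 x y = polyDivDiff q x y := fun {x y} hx hy => by
    have h1 : cothSub 𝕜 (!![x, 1; 0, y] : Matrix (Fin 2) (Fin 2) R) = _ :=
      cothSub_eq_aeval hm2 hp2 hq (aeval_block_sq 𝕜 1 hx hy)
    rw [cothDivDiff, h1, polyDivDiff]
  have key := cothSub_functional_equation 𝕜 h (hu ha) (hu hb) (hu hc) (hub hc' hb) (hub ha' hc)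
    (hub hb' ha)
  rwa [hsb hc' hb, hsb ha' hc, hsb hb' ha, hs ha, hs hb, hs hc] at key

theorem polyDivDiff_functional_equation_smul {m q : 𝕜[X]} (hm : m ≠ 0) (hp : AvoidsPoles m)
    (hq : JetAgree cothF (m ^ 2) q) {R : Type*} [CommRing R] [Algebra 𝕜 R] [FiniteDimensional 𝕜 R]
    {M : Type*} [AddCommGroup M] [Module R M] (t : M)
    {a b c : R} (h : (a + b + c) • t = 0) (ha : Polynomial.aeval a m = 0)
    (hb : Polynomial.aeval b m = 0) (hc : Polynomial.aeval c m = 0)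
    (ha' : Polynomial.aeval (-a) m = 0) (hb' : Polynomial.aeval (-b) m = 0)
    (hc' : Polynomial.aeval (-c) m = 0) :
    (polyDivDiff q (-c) b + polyDivDiff q (-a) c + polyDivDiff q (-b) a
      - (Polynomial.aeval a q * Polynomial.aeval b q + Polynomial.aeval b q * Polynomial.aeval c q
        + Polynomial.aeval c q * Polynomial.aeval a q)) • t = t := by
  -- The sum `a + b + c` only kills `t`; it becomes zero modulo the annihilator of `t`.
  let I : Ideal R := LinearMap.ker (LinearMap.toSpanSingleton R M t)
  let π : R →ₐ[𝕜] R ⧸ I := Ideal.Quotient.mkₐ 𝕜 I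
  have hI : ∀ x : R, π x = 0 ↔ x • t = 0 := fun x => Ideal.Quotient.eq_zero_iff_mem
  have h0 : ∀ {x : R}, Polynomial.aeval x m = 0 → Polynomial.aeval (π x) m = 0 := fun hx => by
    rw [Polynomial.aeval_algHom_apply, hx, map_zero]
  have : FiniteDimensional 𝕜 (R ⧸ I) :=
    Module.Finite.of_surjective π.toLinearMap (Ideal.Quotient.mkₐ_surjective 𝕜 I)
  have key := polyDivDiff_functional_equation (R := R ⧸ I) hm hp hq (a := π a) (b := π b) (c := π c)
    (by rw [← map_add, ← map_add]; exact (hI _).mpr h) (h0 ha) (h0 hb) (h0 hc)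
    (by rw [← map_neg]; exact h0 ha') (by rw [← map_neg]; exact h0 hb')
    (by rw [← map_neg]; exact h0 hc')
  simp only [← map_neg, ← map_polyDivDiff, Polynomial.aeval_algHom_apply, ← map_mul,
    ← map_add, ← map_sub] at key
  rw [← sub_eq_zero, ← map_one π, ← map_sub, hI, sub_smul, one_smul, sub_eq_zero] at key
  exact key

theorem polyDivDiff_functional_equation_apply {m q : 𝕜[X]} (hm : m ≠ 0) (hp : AvoidsPoles m)
    (hq : JetAgree cothF (m ^ 2) q) {M : Type*} [AddCommGroup M] [Module 𝕜 M]
    [FiniteDimensional 𝕜 M] (t : M) {a b c : Module.End 𝕜 M} (hab : Commute a b)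
    (hbc : Commute b c) (hac : Commute a c) (h : (a + b + c) t = 0)
    (ha : Polynomial.aeval a m = 0) (hb : Polynomial.aeval b m = 0) (hc : Polynomial.aeval c m = 0)
    (ha' : Polynomial.aeval (-a) m = 0) (hb' : Polynomial.aeval (-b) m = 0)
    (hc' : Polynomial.aeval (-c) m = 0) :
    polyDivDiff q (-c) b t + polyDivDiff q (-a) c t + polyDivDiff q (-b) a t
      - (Polynomial.aeval a q (Polynomial.aeval b q t) + Polynomial.aeval b q (Polynomial.aeval c q t)
        + Polynomial.aeval c q (Polynomial.aeval a q t)) = t := by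
  let s : Set (Module.End 𝕜 M) := {a, b, c}
  have hs : ∀ x ∈ s, ∀ y ∈ s, x * y = y * x := by
    rintro x (rfl | rfl | rfl) y (rfl | rfl | rfl)
    exacts [rfl, hab.eq, hac.eq, hab.symm.eq, rfl, hbc.eq, hac.symm.eq, hbc.symm.eq, rfl]
  have := Algebra.isMulCommutative_adjoin 𝕜 hs
  let v : Algebra.adjoin 𝕜 s →ₐ[𝕜] Module.End 𝕜 M := (Algebra.adjoin 𝕜 s).val
  have hv : Function.Injective v := Subtype.val_injective
  let A : Algebra.adjoin 𝕜 s := ⟨a, Algebra.subset_adjoin (by simp [s])⟩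
  let B : Algebra.adjoin 𝕜 s := ⟨b, Algebra.subset_adjoin (by simp [s])⟩
  let C : Algebra.adjoin 𝕜 s := ⟨c, Algebra.subset_adjoin (by simp [s])⟩
  have h0 : ∀ {x : Algebra.adjoin 𝕜 s}, Polynomial.aeval (v x) m = 0 →
      Polynomial.aeval x m = 0 := fun {x} hx => by
    apply hv
    rw [← Polynomial.aeval_algHom_apply, hx, map_zero]
  have key := polyDivDiff_functional_equation_smul (R := Algebra.adjoin 𝕜 s) hm hp hq t
    (a := A) (b := B) (c := C) h (h0 ha) (h0 hb) (h0 hc) (h0 ha') (h0 hb') (h0 hc')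
  have key : v (polyDivDiff q (-C) B + polyDivDiff q (-A) C + polyDivDiff q (-B) A
      - (Polynomial.aeval A q * Polynomial.aeval B q + Polynomial.aeval B q * Polynomial.aeval C q
        + Polynomial.aeval C q * Polynomial.aeval A q)) t = t := key
  simp only [map_sub, map_add, map_mul, map_polyDivDiff, ← Polynomial.aeval_algHom_apply,
    map_neg] at key
  exact key

theorem block_pow_succ_apply {R : Type*} [Ring R] (x y z : R) (n : ℕ) :
    ((!![x, y; 0, z] : Matrix (Fin 2) (Fin 2) R) ^ (n + 1)) 0 1 =
      x * ((!![x, y; 0, z] : Matrix (Fin 2) (Fin 2) R) ^ n) 0 1 + y * z ^ n := by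
  have h1 : ((!![x, y; 0, z] : Matrix (Fin 2) (Fin 2) R) ^ n) 1 1 = z ^ n ∧
      ((!![x, y; 0, z] : Matrix (Fin 2) (Fin 2) R) ^ n) 1 0 = 0 := by
    induction n with
    | zero => simp
    | succ n ih => rw [pow_succ']; simp [Matrix.mul_apply, ih, pow_succ']
  rw [pow_succ', Matrix.mul_apply, Fin.sum_univ_two, h1.1]
  simp

/-- A functional on which `P` and `Q` act through the transposed and the direct action of `T`. -/
theorem polyDivDiff_apply_of_slots {V M : Type*} [AddCommGroup V] [Module 𝕜 V] [AddCommGroup M]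
    [Module 𝕜 M] {T L : Module.End 𝕜 V} {P Q : Module.End 𝕜 M} {t : M} {β : V → V →ₗ[𝕜] 𝕜}
    (S : V → V → M →ₗ[𝕜] 𝕜) (hP : ∀ v w f, S v w (P f) = -S v (T w) f)
    (hQ : ∀ v w f, S v w (Q f) = S (T v) w f) (ht : ∀ v w, S v w t = β w (L v))
    (hβ : ∀ w v, β (T w) v = -β w (T v)) (p : 𝕜[X]) (v w : V) :
    S v w (polyDivDiff p P Q t) =
      β w ((Polynomial.aeval (!![T, L; 0, T] : Matrix (Fin 2) (Fin 2) (Module.End 𝕜 V)) p 0 1) v)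
      := by
  have hQn : ∀ n v w f, S v w ((Q ^ n) f) = S ((T ^ n) v) w f := fun n => by
    induction n with
    | zero => simp
    | succ n ih =>
      intro v w f
      rw [pow_succ', Module.End.mul_apply, hQ, ih, ← Module.End.mul_apply, ← pow_succ]
  -- The corners are sums over `i + j = n - 1` of `P ^ i * Q ^ j` and of `T ^ i * L * T ^ j`. Under
  -- `S`, each `Q` becomes a `T` before `L`; each `P` becomes a `T` after `L`, as the signs in `hP`
  -- and `hβ` cancel.
  have hpow : ∀ n v w, S v w (((!![P, 1; 0, Q] : Matrix (Fin 2) (Fin 2) (Module.End 𝕜 M)) ^ n)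
      0 1 t) =
      β w (((!![T, L; 0, T] : Matrix (Fin 2) (Fin 2) (Module.End 𝕜 V)) ^ n) 0 1 v) := fun n => by
    induction n with
    | zero => simp
    | succ n ih =>
      intro v w
      rw [block_pow_succ_apply, block_pow_succ_apply]
      simp only [LinearMap.add_apply, Module.End.mul_apply, map_add, hP, ih, hβ, neg_neg, one_mul,
        hQn, ht]
  induction p using Polynomial.induction_on' with
  | add p q hp hq =>
    simp only [polyDivDiff, map_add, Matrix.add_apply, LinearMap.add_apply] at hp hq ⊢
    rw [hp, hq]
  | monomial n a =>
    simp only [polyDivDiff, Polynomial.aeval_monomial, ← Algebra.smul_def, Matrix.smul_apply,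
      LinearMap.smul_apply, map_smul, hpow]

end Trilinear
end

noncomputable section

open scoped Nat Topology
open Filter

/-! ### The functional equation applied to an invariant bracket -/

section Bilinear

variable {𝕜 : Type*} [RCLike 𝕜] {V : Type*} [AddCommGroup V] [Module 𝕜 V]

/-- Action on an argument reverses products, so multiplicativity is required only along the powers
of a single endomorphism. -/
theorem aeval_slot {M : Type*} [AddCommGroup M] [Module 𝕜 M]
    (s : Module.End 𝕜 V →ₗ[𝕜] Module.End 𝕜 M) (h1 : s 1 = 1) (x : Module.End 𝕜 V)
    (hmul : ∀ n, s (x ^ (n + 1)) = s x * s (x ^ n)) (p : 𝕜[X]) :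
    Polynomial.aeval (s x) p = s (Polynomial.aeval x p) := by
  induction p using Polynomial.induction_on' with
  | add p q hp hq => rw [map_add, hp, hq, map_add, map_add]
  | monomial n a =>
    have h : s (x ^ n) = s x ^ n := by
      induction n with
      | zero => simp [h1]
      | succ n ih => rw [hmul, ih, pow_succ']
    simp only [Polynomial.aeval_monomial, ← Algebra.smul_def, map_smul, h]

variable (𝕜 V) in
/-- The action of endomorphisms on the first argument of bilinear maps. -/
def slotFst : Module.End 𝕜 V →ₗ[𝕜] Module.End 𝕜 (V →ₗ[𝕜] V →ₗ[𝕜] V) :=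
  LinearMap.mk₂ 𝕜 (fun x f => f ∘ₗ x) (fun x y f => by ext; simp) (fun c x f => by ext; simp)
    (fun x f g => by ext; simp) (fun c x f => by ext; simp)

variable (𝕜 V) in
/-- The action of endomorphisms on the second argument of bilinear maps. -/
def slotSnd : Module.End 𝕜 V →ₗ[𝕜] Module.End 𝕜 (V →ₗ[𝕜] V →ₗ[𝕜] V) :=
  LinearMap.mk₂ 𝕜 (fun x f => LinearMap.lcomp 𝕜 _ x ∘ₗ f) (fun x y f => by ext; simp)
    (fun c x f => by ext; simp) (fun x f g => by ext; simp) (fun c x f => by ext; simp)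

variable (𝕜 V) in
/-- The action of endomorphisms on the values of bilinear maps. -/
def slotOut : Module.End 𝕜 V →ₗ[𝕜] Module.End 𝕜 (V →ₗ[𝕜] V →ₗ[𝕜] V) :=
  LinearMap.mk₂ 𝕜 (fun x f => f.compr₂ x)
    (fun x y f => by ext; simp) (fun c x f => by ext; simp) (fun x f g => by ext; simp)
    (fun c x f => by ext; simp)

variable (x : Module.End 𝕜 V) (f : V →ₗ[𝕜] V →ₗ[𝕜] V) (u v w : V)

@[simp] theorem slotFst_apply : slotFst 𝕜 V x f u v = f (x u) v := rfl

@[simp] theorem slotSnd_apply : slotSnd 𝕜 V x f u v = f u (x v) := rfl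

@[simp] theorem slotOut_apply : slotOut 𝕜 V x f u v = x (f u v) := rfl

theorem aeval_slotFst (p : 𝕜[X]) :
    Polynomial.aeval (slotFst 𝕜 V x) p = slotFst 𝕜 V (Polynomial.aeval x p) :=
  aeval_slot (slotFst 𝕜 V) (by ext; simp) x (fun n => by ext; simp [pow_succ]) p

theorem aeval_slotSnd (p : 𝕜[X]) :
    Polynomial.aeval (slotSnd 𝕜 V x) p = slotSnd 𝕜 V (Polynomial.aeval x p) :=
  aeval_slot (slotSnd 𝕜 V) (by ext; simp) x (fun n => by ext; simp [pow_succ]) p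

theorem aeval_slotOut (p : 𝕜[X]) :
    Polynomial.aeval (slotOut 𝕜 V x) p = slotOut 𝕜 V (Polynomial.aeval x p) :=
  aeval_slot (slotOut 𝕜 V) (by ext; simp) x (fun n => by ext; simp [pow_succ']) p

/-- The trilinear form of a bilinear map and a pairing, as a functional of the bilinear map. -/
def evalPairing (β : V → V →ₗ[𝕜] 𝕜) (u v w : V) : (V →ₗ[𝕜] V →ₗ[𝕜] V) →ₗ[𝕜] 𝕜 where
  toFun f := β w (f u v)
  map_add' _ _ := by simp
  map_smul' _ _ := by simp

/-- The functional equation of `F(z) = coth z - 1 / z`, on an invariant cyclic trilinear form. -/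
theorem trilinear_functional_equation [FiniteDimensional 𝕜 V] {m q : 𝕜[X]} (hm : m ≠ 0)
    (hp : AvoidsPoles m) (hq : JetAgree cothF (m ^ 2) q) {T : Module.End 𝕜 V}
    (hT : Polynomial.aeval T m = 0) (hT' : Polynomial.aeval (-T) m = 0)
    (hqT : Polynomial.aeval (-T) q = -Polynomial.aeval T q)
    {t : V →ₗ[𝕜] V →ₗ[𝕜] V} (ht : ∀ u v, T (t u v) = t (T u) v + t u (T v))
    {β : V → V →ₗ[𝕜] 𝕜} (hβ : ∀ w v, β (T w) v = -β w (T v))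
    (hβq : ∀ w v, β (Polynomial.aeval T q w) v = -β w (Polynomial.aeval T q v))
    (hcyc : ∀ u v w, β w (t u v) = β u (t v w)) (u v w : V) :
    β w ((Polynomial.aeval (!![T, t u; 0, T] : Matrix (Fin 2) (Fin 2) (Module.End 𝕜 V)) q 0 1) v)
      + β u ((Polynomial.aeval
          (!![T, t v; 0, T] : Matrix (Fin 2) (Fin 2) (Module.End 𝕜 V)) q 0 1) w)
      + β v ((Polynomial.aeval
          (!![T, t w; 0, T] : Matrix (Fin 2) (Fin 2) (Module.End 𝕜 V)) q 0 1) u)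
      - (β w (t (Polynomial.aeval T q u) (Polynomial.aeval T q v))
        + β u (t (Polynomial.aeval T q v) (Polynomial.aeval T q w))
        + β v (t (Polynomial.aeval T q w) (Polynomial.aeval T q u))) = β w (t u v) := by
  -- The derivation property of `T` says precisely that these three commuting operators have a sum
  -- that kills `t`.
  have key := polyDivDiff_functional_equation_apply hm hp hq t (a := slotFst 𝕜 V T)
    (b := slotSnd 𝕜 V T) (c := slotOut 𝕜 V (-T)) (by ext; simp) (by ext; simp) (by ext; simp)
    (by ext u v; simp [ht u v]) (by rw [aeval_slotFst, hT, map_zero])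
    (by rw [aeval_slotSnd, hT, map_zero]) (by rw [aeval_slotOut, hT', map_zero])
    (by rw [show -slotFst 𝕜 V T = slotFst 𝕜 V (-T) by ext; simp, aeval_slotFst, hT', map_zero])
    (by rw [show -slotSnd 𝕜 V T = slotSnd 𝕜 V (-T) by ext; simp, aeval_slotSnd, hT', map_zero])
    (by rw [show -slotOut 𝕜 V (-T) = slotOut 𝕜 V T by ext; simp, aeval_slotOut, hT, map_zero])
  -- Each divided difference leaves one argument untouched: `u`, then `v`, then `w`. That argument
  -- becomes the direction of the derivative, after a cyclic rotation of the trilinear form.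
  have e1 := polyDivDiff_apply_of_slots (T := T) (L := t u) (P := -slotOut 𝕜 V (-T))
    (Q := slotSnd 𝕜 V T) (t := t) (β := β) (fun v w => evalPairing β u v w)
    (fun v w f => by simp [evalPairing, hβ]) (fun _ _ _ => rfl) (fun _ _ => rfl) hβ q v w
  have e2 := polyDivDiff_apply_of_slots (T := T) (L := t v) (P := -slotFst 𝕜 V T)
    (Q := slotOut 𝕜 V (-T)) (t := t) (β := β) (fun w u => evalPairing β u v w)
    (fun _ _ _ => by simp [evalPairing]) (fun w u f => by simp [evalPairing, hβ])
    (fun w u => hcyc u v w) hβ q w u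
  have e3 := polyDivDiff_apply_of_slots (T := T) (L := t w) (P := -slotSnd 𝕜 V T)
    (Q := slotFst 𝕜 V T) (t := t) (β := β) (fun u v => evalPairing β u v w)
    (fun _ _ _ => by simp [evalPairing]) (fun _ _ _ => rfl)
    (fun u v => (hcyc u v w).trans (hcyc v w u)) hβ q u v
  have h := congrArg (evalPairing β u v w) key
  simp only [map_sub, map_add] at h
  rw [e1, e2, e3, aeval_slotFst, aeval_slotSnd, aeval_slotOut, hqT] at h
  have h1 : evalPairing β u v w (slotSnd 𝕜 V (Polynomial.aeval T q)
      (slotOut 𝕜 V (-Polynomial.aeval T q) t)) =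
      β u (t (Polynomial.aeval T q v) (Polynomial.aeval T q w)) := by
    rw [← hcyc, hβq]
    simp [evalPairing]
  have h2 : evalPairing β u v w (slotOut 𝕜 V (-Polynomial.aeval T q)
      (slotFst 𝕜 V (Polynomial.aeval T q) t)) =
      β v (t (Polynomial.aeval T q w) (Polynomial.aeval T q u)) := by
    rw [← hcyc, ← hcyc, hβq]
    simp [evalPairing]
  rw [h1, h2] at h
  exact h

end Bilinear
end

noncomputable section

open scoped Nat Topology
open Filter

/-! ### The exponential of an endomorphism -/

section LinExp

attribute [local instance] Matrix.linftyOpNormedRing Matrix.linftyOpNormedAlgebra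

variable {𝕜 : Type*} [RCLike 𝕜] {V : Type*} [AddCommGroup V] [Module 𝕜 V] [FiniteDimensional 𝕜 V]
  {V' : Type*} [AddCommGroup V'] [Module 𝕜 V'] [FiniteDimensional 𝕜 V']
  {W : Type*} [AddCommGroup W] [Module 𝕜 W]

/-- Through functionals the exponential series becomes scalar. Identities between linear images of
exponentials thus reduce to powers, with no topology on `V`. -/
theorem hasSum_apply_linExp (l : Module.End 𝕜 V →ₗ[𝕜] 𝕜) (x : Module.End 𝕜 V) :
    HasSum (fun n => ((n ! : 𝕜))⁻¹ * l (x ^ n)) (l (linExp x)) := by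
  let b := Module.finBasis 𝕜 V
  let e := (LinearMap.toMatrixAlgEquiv b).symm
  have := FiniteDimensional.complete 𝕜
    (Matrix (Fin (Module.finrank 𝕜 V)) (Fin (Module.finrank 𝕜 V)) 𝕜)
  have h := NormedSpace.exp_series_hasSum_exp' (𝕂 := 𝕜) (LinearMap.toMatrixAlgEquiv b x)
  have hc : Continuous (l ∘ₗ e.toLinearMap) := LinearMap.continuous_of_finiteDimensional _
  have h2 := h.map (l ∘ₗ e.toLinearMap) hc
  have e1 : (l ∘ₗ e.toLinearMap) (NormedSpace.exp (LinearMap.toMatrixAlgEquiv b x)) =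
      l (linExp x) := rfl
  rw [← e1]
  have e2 : (fun n => ((n ! : 𝕜))⁻¹ * l (x ^ n)) = (l ∘ₗ e.toLinearMap) ∘
      fun n => ((n ! : 𝕜))⁻¹ • (LinearMap.toMatrixAlgEquiv b x) ^ n := by
    funext n
    have e3 : e (LinearMap.toMatrixAlgEquiv b x ^ n) = x ^ n := by
      rw [map_pow, AlgEquiv.symm_apply_apply]
    simp only [Function.comp_apply, map_smul, smul_eq_mul]
    exact congrArg (fun y => ((n ! : 𝕜))⁻¹ * l y) e3.symm
  rw [e2]
  exact h2

theorem apply_linExp_eq (f : Module.End 𝕜 V →ₗ[𝕜] W) (h : Module.End 𝕜 V' →ₗ[𝕜] W)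
    {x : Module.End 𝕜 V} {y : Module.End 𝕜 V'} (hn : ∀ n, f (x ^ n) = h (y ^ n)) :
    f (linExp x) = h (linExp y) := by
  rw [← sub_eq_zero, ← Module.forall_dual_apply_eq_zero_iff 𝕜]
  intro l
  rw [map_sub, sub_eq_zero]
  refine (hasSum_apply_linExp (l ∘ₗ f) x).unique ?_
  have h1 := hasSum_apply_linExp (l ∘ₗ h) y
  simpa only [LinearMap.comp_apply, hn] using h1

theorem linExp_add_of_commute {x y : Module.End 𝕜 V} (h : Commute x y) :
    linExp (x + y) = linExp x * linExp y := by
  let b := Module.finBasis 𝕜 V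
  have h1 := Matrix.exp_add_of_commute _ _ (h.map (LinearMap.toMatrixAlgEquiv b))
  rw [← map_add] at h1
  have h2 := congrArg (LinearMap.toMatrixAlgEquiv b).symm h1
  rw [map_mul] at h2
  exact h2

theorem linExp_zero : linExp (0 : Module.End 𝕜 V) = 1 := by
  simp [linExp, Module.End.one_eq_id]

theorem linExp_mul_linExp_neg (x : Module.End 𝕜 V) : linExp x * linExp (-x) = 1 := by
  rw [← linExp_add_of_commute (Commute.neg_right (Commute.refl x)), add_neg_cancel, linExp_zero]

theorem linExp_neg_mul_linExp (x : Module.End 𝕜 V) : linExp (-x) * linExp x = 1 := by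
  rw [← linExp_add_of_commute (Commute.neg_left (Commute.refl x)), neg_add_cancel, linExp_zero]

theorem linExp_slot {M : Type*} [AddCommGroup M] [Module 𝕜 M] [FiniteDimensional 𝕜 M]
    (s : Module.End 𝕜 V →ₗ[𝕜] Module.End 𝕜 M) (h1 : s 1 = 1) (x : Module.End 𝕜 V)
    (hmul : ∀ n, s (x ^ (n + 1)) = s x * s (x ^ n)) : linExp (s x) = s (linExp x) := by
  refine (apply_linExp_eq s LinearMap.id fun n => ?_).symm
  induction n with
  | zero => simp [h1]
  | succ n ih => rw [hmul, ih, pow_succ']; rfl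

theorem linExp_apply_eq_self {x : Module.End 𝕜 V} {v : V} (h : x v = 0) : linExp x v = v := by
  have h1 := apply_linExp_eq (LinearMap.applyₗ v) (LinearMap.applyₗ v) (x := x)
    (y := (0 : Module.End 𝕜 V)) fun n => by
      cases n with
      | zero => simp
      | succ n => simp [pow_succ, h]
  simpa [linExp_zero] using h1

theorem linExp_apply_of_transpose {Z : Module.End 𝕜 V'} {A : Module.End 𝕜 V}
    (c : Module.Dual 𝕜 V →ₗ[𝕜] V') (h : ∀ ξ, Z (c ξ) = c (ξ ∘ₗ A)) (ξ : Module.Dual 𝕜 V) :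
    linExp Z (c ξ) = c (ξ ∘ₗ linExp A) := by
  let co : Module.End 𝕜 V →ₗ[𝕜] V' := c ∘ₗ LinearMap.compRight 𝕜 ξ
  suffices hn : ∀ n, (Z ^ n) (c ξ) = c (ξ ∘ₗ (A ^ n)) from
    apply_linExp_eq (LinearMap.applyₗ (c ξ)) co (x := Z) (y := A) hn
  intro n
  induction n with
  | zero => rw [pow_zero, pow_zero, Module.End.one_apply, Module.End.one_eq_id, LinearMap.comp_id]
  | succ n ih =>
    rw [pow_succ', Module.End.mul_apply, ih, h, pow_succ, Module.End.mul_eq_comp,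
      LinearMap.comp_assoc]

/-- The exponential of a derivation is an automorphism. -/
theorem linExp_apply_bilinear {t : V →ₗ[𝕜] V →ₗ[𝕜] V} {Z : Module.End 𝕜 V}
    (hZ : ∀ u v, Z (t u v) = t (Z u) v + t u (Z v)) (u v : V) :
    linExp Z (t u v) = t (linExp Z u) (linExp Z v) := by
  let F := slotFst 𝕜 V Z
  let S := slotSnd 𝕜 V Z
  let O := slotOut 𝕜 V Z
  have hFS : Commute F S := by ext; simp [F, S]
  -- By the derivation property `F + S - O` kills `t`, so its exponential fixes `t` and `exp F * exp
  -- S` acts on `t` as `exp O`.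
  have hO : Commute O (F + S - O) := by ext; simp [F, S, O]
  have h1 : linExp (F + S - O) t = t :=
    linExp_apply_eq_self (by ext u v; simp [F, S, O, hZ])
  have h2 : linExp F * linExp S = linExp O * linExp (F + S - O) := by
    have e : F + S = O + (F + S - O) := by ext; simp
    rw [← linExp_add_of_commute hFS, ← linExp_add_of_commute hO, ← e]
  have h3 := congrArg (fun X : Module.End 𝕜 (V →ₗ[𝕜] V →ₗ[𝕜] V) => X t u v) h2
  simp only [Module.End.mul_apply, h1] at h3
  rw [linExp_slot (slotFst 𝕜 V) (by ext; simp) Z (fun n => by ext; simp [pow_succ]),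
    linExp_slot (slotSnd 𝕜 V) (by ext; simp) Z (fun n => by ext; simp [pow_succ]),
    linExp_slot (slotOut 𝕜 V) (by ext; simp) Z (fun n => by ext; simp [pow_succ'])] at h3
  exact h3.symm

end LinExp
end

noncomputable section

open scoped Nat Topology
open Filter

/-! ### Polynomials in an endomorphism -/

section Aeval

variable {𝕜 : Type*} [RCLike 𝕜] {V : Type*} [AddCommGroup V] [Module 𝕜 V]

/-- Polynomials in intertwined endomorphisms are intertwined. -/
theorem aeval_intertwine {W : Type*} [AddCommGroup W] [Module 𝕜 W] {T : Module.End 𝕜 V}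
    {S : Module.End 𝕜 W} {j : V →ₗ[𝕜] W} (h : ∀ v, j (T v) = S (j v)) (p : 𝕜[X]) (v : V) :
    j (Polynomial.aeval T p v) = Polynomial.aeval S p (j v) := by
  induction p using Polynomial.induction_on' with
  | add p q hp hq => simp [hp, hq]
  | monomial n a =>
    have hn : ∀ v, j ((T ^ n) v) = (S ^ n) (j v) := by
      induction n with
      | zero => simp
      | succ n ih => intro v; rw [pow_succ, pow_succ, Module.End.mul_apply, ih, h]; rfl
    simp [Polynomial.aeval_monomial, ← Algebra.smul_def, hn]

/-- Polynomials in a skew-adjoint endomorphism. -/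
theorem aeval_adjoint {T S : Module.End 𝕜 V} {β : V → V →ₗ[𝕜] 𝕜}
    (hadd : ∀ u u' v, β (u + u') v = β u v + β u' v) (hsmul : ∀ (a : 𝕜) u v, β (a • u) v = a * β u v)
    (h : ∀ u v, β (T u) v = β u (S v)) (p : 𝕜[X]) (u v : V) :
    β (Polynomial.aeval T p u) v = β u (Polynomial.aeval S p v) := by
  induction p using Polynomial.induction_on' with
  | add p q hp hq => simp [hp, hq, hadd]
  | monomial n a =>
    have hn : ∀ u v, β ((T ^ n) u) v = β u ((S ^ n) v) := by
      induction n with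
      | zero => simp
      | succ n ih => intro u v; rw [pow_succ', pow_succ, Module.End.mul_apply, h, ih]; rfl
    simp [Polynomial.aeval_monomial, ← Algebra.smul_def, hn, hsmul]

/-- The corner of a polynomial in a block matrix whose corner is a commutator. -/
theorem aeval_block_commutator (Z T : Module.End 𝕜 V) (q : 𝕜[X]) :
    Polynomial.aeval (!![T, Z * T - T * Z; 0, T] : Matrix (Fin 2) (Fin 2) (Module.End 𝕜 V)) q 0 1 =
      Z * Polynomial.aeval T q - Polynomial.aeval T q * Z := by
  have h := Polynomial.aeval_algHom_apply (shearHom 𝕜 Z) (T, T) q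
  rw [Polynomial.aeval_prod_apply, shearHom_apply, shearHom_apply] at h
  rw [h]
  rfl

end Aeval

/-! ### Linear families in a finite-dimensional normed algebra -/

section NormedFamily

attribute [local instance] Matrix.linftyOpNormedRing Matrix.linftyOpNormedAlgebra completeSpace_block

variable {𝕜 : Type*} [RCLike 𝕜] {R : Type*} [NormedRing R] [NormedAlgebra 𝕜 R] [CompleteSpace R]

theorem eventually_isUnit_sinhc {T : R} (hT : IsUnit (sinhc 𝕜 T)) (Y : R) :
    ∀ᶠ s in 𝓝 (0 : 𝕜), IsUnit (sinhc 𝕜 (T + s • Y)) := by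
  have hc : Continuous fun s : 𝕜 => T + s • Y := by fun_prop
  exact hc.continuousAt.eventually_mem ((isOpen_isUnit_sinhc 𝕜 (R := R)).mem_nhds (by simpa using hT))

variable [FiniteDimensional 𝕜 R]

theorem contDiffAt_linear_cothSub {n : ℕ} (f : (Fin n → 𝕜) →ₗ[𝕜] R) (l : R →ₗ[𝕜] 𝕜) {x : Fin n → 𝕜}
    (h : IsUnit (sinhc 𝕜 (f x))) : ContDiffAt 𝕜 ∞ (fun x => l (cothSub 𝕜 (f x))) x := by
  have hf : ContDiff 𝕜 ∞ (LinearMap.toContinuousLinearMap f) := ContinuousLinearMap.contDiff _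
  have hl : ContDiff 𝕜 ∞ (LinearMap.toContinuousLinearMap l) := ContinuousLinearMap.contDiff _
  exact hl.contDiffAt.comp x (ContDiffAt.comp x (g := cothSub 𝕜)
    (f := LinearMap.toContinuousLinearMap f) (contDiffAt_cothSub 𝕜 h) hf.contDiffAt)

theorem hasDerivAt_linear_cothSub (l : R →ₗ[𝕜] 𝕜) {T : R} (h : IsUnit (sinhc 𝕜 T)) (Y : R)
    {m q : 𝕜[X]} (hm : m ≠ 0) (hp : AvoidsPoles m) (hq : JetAgree cothF (m ^ 2) q)
    (hT : Polynomial.aeval T m = 0) :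
    HasDerivAt (fun s : 𝕜 => l (cothSub 𝕜 (T + s • Y)))
      (l (Polynomial.aeval (!![T, Y; 0, T] : Matrix (Fin 2) (Fin 2) R) q 0 1)) 0 := by
  have hm2 : m ^ 2 ≠ 0 := pow_ne_zero 2 hm
  have hp2 : AvoidsPoles (m ^ 2) := by rw [pow_two]; exact hp.mul hp
  have hB : Polynomial.aeval (!![T, Y; 0, T] : Matrix (Fin 2) (Fin 2) R) (m ^ 2) = 0 :=
    aeval_block_sq 𝕜 _ hT hT
  have h1 := tendsto_slope_cothSub 𝕜 h (isUnit_sinhc_of_aeval_eq_zero hm2 hp2 hB)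
  have hBq : (cothSub 𝕜 (!![T, Y; 0, T] : Matrix (Fin 2) (Fin 2) R)) 0 1 =
      Polynomial.aeval (!![T, Y; 0, T] : Matrix (Fin 2) (Fin 2) R) q 0 1 := by
    have h2 := cothSub_eq_aeval hm2 hp2 hq hB
    exact congrArg (fun M : Matrix (Fin 2) (Fin 2) R => M 0 1) h2
  rw [← hBq]
  refine hasDerivAt_iff_tendsto_slope_zero.mpr ?_
  have hl : Continuous l := l.continuous_of_finiteDimensional
  have h2 := (hl.tendsto _).comp h1
  refine Tendsto.congr (fun s => ?_) h2
  simp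

end NormedFamily

/-! ### The function `coth z - 1 / z` of a linear family of endomorphisms -/

section LinearFamily

variable {𝕜 : Type*} [RCLike 𝕜] {V : Type*} [AddCommGroup V] [Module 𝕜 V] [FiniteDimensional 𝕜 V]
  {E : Type*} [AddCommGroup E] [Module 𝕜 E]

theorem matFun_eq_aeval {f : ℂ → ℂ} {T : Module.End 𝕜 V} {q : 𝕜[X]} (h : Interpolates f T q) :
    matFun f T = Polynomial.aeval T q := by
  have h' : ∃ q : 𝕜[X], Interpolates f T q := ⟨q, h⟩
  rw [matFun, dif_pos h']
  exact h'.choose_spec.aeval_eq h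

theorem JetAgree.interpolates {f : ℂ → ℂ} {m q : 𝕜[X]} (hm : m ≠ 0) (h : JetAgree f m q)
    {T : Module.End 𝕜 V} (hd : T.charpoly ∣ m) : Interpolates f T q :=
  JetAgree.of_dvd hm h hd

theorem exists_interpolates_cothF {T : Module.End 𝕜 V} (h : AvoidsPoles T.charpoly) :
    ∃ q : 𝕜[X], Interpolates cothF T q := by
  obtain ⟨-, -, q, -, -, -, hq⟩ := exists_jetAgree_cothF T.charpoly_monic.ne_zero h
  exact ⟨q, hq⟩

theorem avoidsPoles_charpoly_iff {T : Module.End 𝕜 V} : AvoidsPoles T.charpoly ↔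
    letI := leftRegularNormedRing 𝕜 (Module.End 𝕜 V); IsUnit (sinhc 𝕜 T) := by
  refine ⟨fun h => ?_, avoidsPoles_charpoly_of_isUnit⟩
  let := leftRegularNormedRing 𝕜 (Module.End 𝕜 V)
  let := leftRegularNormedAlgebra 𝕜 (Module.End 𝕜 V)
  have := FiniteDimensional.complete 𝕜 (Module.End 𝕜 V)
  exact isUnit_sinhc_of_aeval_eq_zero T.charpoly_monic.ne_zero h T.aeval_self_charpoly

theorem matFun_cothF_eq_cothSub {T : Module.End 𝕜 V} (h : AvoidsPoles T.charpoly) :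
    letI := leftRegularNormedRing 𝕜 (Module.End 𝕜 V); matFun cothF T = cothSub 𝕜 T := by
  let := leftRegularNormedRing 𝕜 (Module.End 𝕜 V)
  let := leftRegularNormedAlgebra 𝕜 (Module.End 𝕜 V)
  have := FiniteDimensional.complete 𝕜 (Module.End 𝕜 V)
  obtain ⟨q, hq⟩ := exists_interpolates_cothF h
  exact (matFun_eq_aeval hq).trans
    (cothSub_eq_aeval T.charpoly_monic.ne_zero h hq T.aeval_self_charpoly).symm

theorem isOpenFD_avoidsPoles (T : E →ₗ[𝕜] Module.End 𝕜 V) :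
    IsOpenFD 𝕜 {p | AvoidsPoles (T p).charpoly} := by
  intro n b
  let := leftRegularNormedRing 𝕜 (Module.End 𝕜 V)
  let := leftRegularNormedAlgebra 𝕜 (Module.End 𝕜 V)
  have := FiniteDimensional.complete 𝕜 (Module.End 𝕜 V)
  have hc : Continuous (T ∘ₗ b.equivFun.symm.toLinearMap) :=
    LinearMap.continuous_of_finiteDimensional _
  have h := (isOpen_isUnit_sinhc 𝕜 (R := Module.End 𝕜 V)).preimage hc
  convert h using 1
  ext x
  exact avoidsPoles_charpoly_iff

theorem contDiffOn_matFun_cothF (T : E →ₗ[𝕜] Module.End 𝕜 V) (l : Module.End 𝕜 V →ₗ[𝕜] 𝕜)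
    {n : ℕ} (b : Module.Basis (Fin n) 𝕜 E) :
    ContDiffOn 𝕜 ∞ (fun x : Fin n → 𝕜 => l (matFun cothF (T (b.equivFun.symm x))))
      {x : Fin n → 𝕜 | AvoidsPoles (T (b.equivFun.symm x)).charpoly} := by
  let := leftRegularNormedRing 𝕜 (Module.End 𝕜 V)
  let := leftRegularNormedAlgebra 𝕜 (Module.End 𝕜 V)
  have := FiniteDimensional.complete 𝕜 (Module.End 𝕜 V)
  have h : ContDiffOn 𝕜 ∞ (fun x : Fin n → 𝕜 => l (cothSub 𝕜 (T (b.equivFun.symm x))))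
      {x : Fin n → 𝕜 | AvoidsPoles (T (b.equivFun.symm x)).charpoly} := fun x hx =>
    (contDiffAt_linear_cothSub (T ∘ₗ b.equivFun.symm.toLinearMap) l
      (avoidsPoles_charpoly_iff.mp hx)).contDiffWithinAt
  exact h.congr fun x hx => congrArg l (matFun_cothF_eq_cothSub hx)

theorem lineDeriv_matFun_cothF (T : E →ₗ[𝕜] Module.End 𝕜 V)
    (l : Module.End 𝕜 V →ₗ[𝕜] 𝕜)
    {p v : E} (h : AvoidsPoles (T p).charpoly) {m q : 𝕜[X]} (hm : m ≠ 0) (hp : AvoidsPoles m)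
    (hq : JetAgree cothF (m ^ 2) q) (hT : Polynomial.aeval (T p) m = 0) :
    lineDeriv 𝕜 (fun x => l (matFun cothF (T x))) p v =
      l (Polynomial.aeval (!![T p, T v; 0, T p] : Matrix (Fin 2) (Fin 2) (Module.End 𝕜 V)) q 0 1) := by
  let := leftRegularNormedRing 𝕜 (Module.End 𝕜 V)
  let := leftRegularNormedAlgebra 𝕜 (Module.End 𝕜 V)
  have := FiniteDimensional.complete 𝕜 (Module.End 𝕜 V)
  have h1 := hasDerivAt_linear_cothSub l (avoidsPoles_charpoly_iff.mp h) (T v) hm hp hq hT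
  refine HasDerivAt.deriv (h1.congr_of_eventuallyEq ?_)
  have ho := eventually_isUnit_sinhc (𝕜 := 𝕜) (avoidsPoles_charpoly_iff.mp h) (T v)
  filter_upwards [ho] with s hs
  rw [map_add, map_smul]
  exact congrArg l (matFun_cothF_eq_cothSub (avoidsPoles_charpoly_iff.mpr hs))

/-- A common interpolating polynomial for `T` and `-T`. -/
theorem exists_odd_interpolation {T : Module.End 𝕜 V} (h : AvoidsPoles T.charpoly) :
    ∃ m q : 𝕜[X], m ≠ 0 ∧ AvoidsPoles m ∧ T.charpoly ∣ m ∧ JetAgree cothF (m ^ 2) q ∧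
      Polynomial.aeval T m = 0 ∧ Polynomial.aeval (-T) m = 0 ∧ matFun cothF T = Polynomial.aeval T q ∧
      Polynomial.aeval (-T) q = -Polynomial.aeval T q := by
  let := leftRegularNormedRing 𝕜 (Module.End 𝕜 V)
  let := leftRegularNormedAlgebra 𝕜 (Module.End 𝕜 V)
  have := FiniteDimensional.complete 𝕜 (Module.End 𝕜 V)
  have h0 := T.charpoly_monic.ne_zero
  have hX : (-Polynomial.X : 𝕜[X]).comp (-Polynomial.X) = Polynomial.X := by simp
  have h1 : T.charpoly.comp (-Polynomial.X) ≠ 0 := fun h1 => h0 (by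
    have h2 := congrArg (fun r : 𝕜[X] => r.comp (-Polynomial.X)) h1
    simpa only [Polynomial.comp_assoc, hX, Polynomial.comp_X, Polynomial.zero_comp] using h2)
  -- The modulus `χ(X) χ(-X)` kills both `T` and `-T`, and still avoids the poles since these are
  -- symmetric about `0`. The oddness of `F` therefore passes to `q`.
  have hm := mul_ne_zero h0 h1
  have hp := h.mul h.comp_neg
  have hm2 := pow_ne_zero 2 hm
  have hp2 : AvoidsPoles ((T.charpoly * T.charpoly.comp (-Polynomial.X)) ^ 2) := by
    rw [pow_two]; exact hp.mul hp
  obtain ⟨-, -, q, -, -, -, hq⟩ := exists_jetAgree_cothF hm2 hp2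
  have hT : Polynomial.aeval T (T.charpoly * T.charpoly.comp (-Polynomial.X)) = 0 := by
    rw [map_mul, LinearMap.aeval_self_charpoly, zero_mul]
  have hT' : Polynomial.aeval (-T) (T.charpoly * T.charpoly.comp (-Polynomial.X)) = 0 := by
    rw [map_mul, Polynomial.aeval_comp, map_neg, Polynomial.aeval_X, neg_neg,
      LinearMap.aeval_self_charpoly, mul_zero]
  refine ⟨_, q, hm, hp, dvd_mul_right _ _, hq, hT, hT',
    matFun_eq_aeval (hq.interpolates hm2 (dvd_pow (dvd_mul_right _ _) two_ne_zero)), ?_⟩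
  rw [← cothSub_eq_aeval hm2 hp2 hq (by rw [map_pow, hT', zero_pow two_ne_zero]),
    ← cothSub_eq_aeval hm2 hp2 hq (by rw [map_pow, hT, zero_pow two_ne_zero]), cothSub_neg]

end LinearFamily

end

noncomputable section

open scoped Topology
open Filter

/-! ### The canonical double of a cocommutative Lie quasi-bialgebra -/

section Double

variable {𝕜 : Type*} [RCLike 𝕜] {g : Type*} [LieRing g] [LieAlgebra 𝕜 g]

/-- The invariant symmetric pairing on the double. -/
def doublePairing (w : g × Module.Dual 𝕜 g) : (g × Module.Dual 𝕜 g) →ₗ[𝕜] 𝕜 :=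
  LinearMap.coprod w.2 (Module.Dual.eval 𝕜 g w.1)

theorem doublePairing_apply (w v : g × Module.Dual 𝕜 g) :
    doublePairing w v = w.2 v.1 + v.2 w.1 := rfl

theorem doublePairing_comm (w v : g × Module.Dual 𝕜 g) :
    doublePairing w v = doublePairing v w := add_comm _ _

theorem adStar_zero : adStar (0 : g) = (0 : Module.Dual 𝕜 g →ₗ[𝕜] Module.Dual 𝕜 g) := by
  ext; simp

/-- The reflection of the double which fixes `g`. -/
def doubleReflection : (g × Module.Dual 𝕜 g) →ₗ[𝕜] g × Module.Dual 𝕜 g :=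
  LinearMap.prodMap LinearMap.id (-LinearMap.id)

theorem doubleReflection_apply (v : g × Module.Dual 𝕜 g) : doubleReflection v = (v.1, -v.2) := rfl

theorem trivector_rotate (φ : Module.Dual 𝕜 g [⋀^Fin 3]→ₗ[𝕜] 𝕜) (ξ η ζ : Module.Dual 𝕜 g) :
    φ ![η, ζ, ξ] = φ ![ξ, η, ζ] := by
  have h := φ.map_perm ![ξ, η, ζ] (finRotate 3)
  have e : ![ξ, η, ζ] ∘ finRotate 3 = ![η, ζ, ξ] := by
    funext i; fin_cases i <;> rfl
  rw [e, sign_finRotate] at h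
  simpa using h

variable [FiniteDimensional 𝕜 g]

theorem contract_zero_left (φ : Module.Dual 𝕜 g [⋀^Fin 3]→ₗ[𝕜] 𝕜) (η : Module.Dual 𝕜 g) :
    contract φ 0 η = 0 := ext_dual (𝕜 := 𝕜) fun ζ => by
  simpa using trivector_smul₀ φ 0 η ζ 0

theorem contract_neg_right (φ : Module.Dual 𝕜 g [⋀^Fin 3]→ₗ[𝕜] 𝕜) (ξ η : Module.Dual 𝕜 g) :
    contract φ ξ (-η) = -contract φ ξ η := ext_dual (𝕜 := 𝕜) fun ζ => by
  have e : (-1 : 𝕜) • η = -η := LinearMap.ext fun x => neg_one_mul (η x)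
  simpa [e] using trivector_smul₁ φ η ξ ζ (-1)

theorem doubleBracket_zero_apply (φ : Module.Dual 𝕜 g [⋀^Fin 3]→ₗ[𝕜] 𝕜)
    (u v : g × Module.Dual 𝕜 g) : doubleBracket 0 φ u v =
      (⁅u.1, v.1⁆ + contract φ u.2 v.2, -adStar u.1 v.2 + adStar v.1 u.2) := by
  refine Prod.ext ?_ ?_
  · simp [doubleBracket]
  · ext; simp [doubleBracket]

theorem doublePairing_cyclic (φ : Module.Dual 𝕜 g [⋀^Fin 3]→ₗ[𝕜] 𝕜)
    (u v w : g × Module.Dual 𝕜 g) :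
    doublePairing w (doubleBracket 0 φ u v) = doublePairing u (doubleBracket 0 φ v w) := by
  simp only [doublePairing_apply, doubleBracket_zero_apply, map_add, apply_contract,
    LinearMap.add_apply, LinearMap.neg_apply, adStar_apply]
  rw [trivector_rotate φ u.2 v.2 w.2, ← lie_skew u.1 v.1, ← lie_skew w.1 u.1]
  simp only [map_neg]
  ring

end Double

/-! ### The dynamical `r`-matrix from the adjoint action on the double -/

namespace LieQuasiBialgebra

variable {𝕜 : Type*} [RCLike 𝕜] {g : Type*} [LieRing g] [LieAlgebra 𝕜 g] [FiniteDimensional 𝕜 g]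
  (G : LieQuasiBialgebra 𝕜 g)

/-- The bracket of the canonical double. -/
def bracket : (g × Module.Dual 𝕜 g) →ₗ[𝕜] (g × Module.Dual 𝕜 g) →ₗ[𝕜] (g × Module.Dual 𝕜 g) :=
  doubleBracket G.ϖ G.φ

/-- The map `p ↦ ad^𝔡_p` as a linear map. -/
def adDoubleHom : Module.Dual 𝕜 g →ₗ[𝕜] Module.End 𝕜 (g × Module.Dual 𝕜 g) :=
  G.bracket ∘ₗ LinearMap.inr 𝕜 g (Module.Dual 𝕜 g)

theorem adDoubleHom_apply_apply (p : Module.Dual 𝕜 g) (v : g × Module.Dual 𝕜 g) :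
    G.adDoubleHom p v = G.bracket (0, p) v := rfl

theorem bracket_skew (u v : g × Module.Dual 𝕜 g) : G.bracket u v = -G.bracket v u := by
  have h := G.double_isLie.1 (u + v)
  rw [map_add, map_add, LinearMap.add_apply, LinearMap.add_apply, G.double_isLie.1 u,
    G.double_isLie.1 v, zero_add, add_zero] at h
  exact eq_neg_of_add_eq_zero_right h

theorem bracket_leibniz (u v w : g × Module.Dual 𝕜 g) :
    G.bracket u (G.bracket v w) = G.bracket (G.bracket u v) w + G.bracket v (G.bracket u w) := by
  have h : G.bracket u (G.bracket v w) + G.bracket v (G.bracket w u) +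
    G.bracket w (G.bracket u v) = 0 := G.double_isLie.2 u v w
  rw [G.bracket_skew w u, G.bracket_skew w (G.bracket u v), map_neg] at h
  rw [← sub_eq_zero, ← h]
  abel

variable {G}

theorem bracket_eq (hG : G.IsCocommutative) : G.bracket = doubleBracket 0 G.φ := by
  rw [bracket, hG]

theorem bracket_apply (hG : G.IsCocommutative) (u v : g × Module.Dual 𝕜 g) : G.bracket u v =
    (⁅u.1, v.1⁆ + contract G.φ u.2 v.2, -adStar u.1 v.2 + adStar v.1 u.2) := by
  rw [bracket_eq hG, doubleBracket_zero_apply]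

theorem bracket_inl_inr (hG : G.IsCocommutative) (z : g) (ξ : Module.Dual 𝕜 g) :
    G.bracket (z, 0) (0, ξ) = (0, -adStar z ξ) := by
  rw [bracket_apply hG]
  simp [contract_zero_left]

theorem pairing_cyclic (hG : G.IsCocommutative) (u v w : g × Module.Dual 𝕜 g) :
    doublePairing w (G.bracket u v) = doublePairing u (G.bracket v w) := by
  rw [bracket_eq hG, doublePairing_cyclic]

theorem pairing_adDoubleHom (hG : G.IsCocommutative) (p : Module.Dual 𝕜 g)
    (u v : g × Module.Dual 𝕜 g) :
    doublePairing (G.adDoubleHom p u) v = -doublePairing u (G.adDoubleHom p v) := by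
  rw [adDoubleHom_apply_apply, adDoubleHom_apply_apply, doublePairing_comm, pairing_cyclic hG,
    pairing_cyclic hG, G.bracket_skew v, map_neg]

/-- The reflection of the double changes the sign of `ad^𝔡_p`. -/
theorem reflection_adDoubleHom (hG : G.IsCocommutative) (p : Module.Dual 𝕜 g)
    (v : g × Module.Dual 𝕜 g) :
    doubleReflection (G.adDoubleHom p v) = (-G.adDoubleHom p) (doubleReflection v) := by
  rw [LinearMap.neg_apply, adDoubleHom_apply_apply, adDoubleHom_apply_apply, bracket_apply hG,
    bracket_apply hG, doubleReflection_apply, doubleReflection_apply]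
  simp only [zero_lie, contract_neg_right, adStar_zero, LinearMap.zero_apply, Prod.neg_mk]
  simp

/-- The reflection turns `ad_p` into `-ad_p`, so it anticommutes with an odd function of `ad_p`,
which then sends the eigenspace `g*` of `-1` into the eigenspace `g` of `1`. -/
theorem aeval_reflection (hG : G.IsCocommutative) {p : Module.Dual 𝕜 g} {q : 𝕜[X]}
    (hq : Polynomial.aeval (-G.adDoubleHom p) q = -Polynomial.aeval (G.adDoubleHom p) q)
    (ξ : Module.Dual 𝕜 g) : (Polynomial.aeval (G.adDoubleHom p) q (0, ξ)).2 = 0 := by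
  have h := congrArg Prod.snd (aeval_intertwine (reflection_adDoubleHom hG p) q (0, ξ))
  have e : doubleReflection ((0, ξ) : g × Module.Dual 𝕜 g) = -(0, ξ) := by
    simp [doubleReflection_apply]
  rw [hq, e, map_neg, LinearMap.neg_apply, neg_neg] at h
  exact LinearMap.ext fun x => self_eq_neg.mp (LinearMap.congr_fun h.symm x)

theorem amDouble_inr (hG : G.IsCocommutative) {p : Module.Dual 𝕜 g} (hp : p ∈ G.amDomain)
    (ξ : Module.Dual 𝕜 g) : G.amDouble p (0, ξ) = (G.rAM p ξ, 0) := by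
  obtain ⟨m, q, -, -, -, -, -, -, hF, hodd⟩ :=
    exists_odd_interpolation (T := G.adDoubleHom p) hp
  refine Prod.ext rfl ?_
  have h := aeval_reflection hG hodd ξ
  rwa [← hF] at h

/-- The adjoint of `q(ad_p)` for the pairing is `q(-ad_p) = -q(ad_p)`. -/
theorem isSkewMap_rAM (hG : G.IsCocommutative) {p : Module.Dual 𝕜 g} (hp : p ∈ G.amDomain) :
    IsSkewMap (G.rAM p) := by
  obtain ⟨m, q, -, -, -, -, -, -, hF, hodd⟩ :=
    exists_odd_interpolation (T := G.adDoubleHom p) hp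
  have hβ := aeval_adjoint (β := doublePairing) (T := G.adDoubleHom p) (S := -G.adDoubleHom p)
    (fun u u' v => by simp [doublePairing_apply]; ring)
    (fun a u v => by simp [doublePairing_apply]; ring)
    (fun u v => by rw [pairing_adDoubleHom hG]; simp) q
  intro ξ η
  have h := hβ (0, ξ) (0, η)
  rw [hodd, ← hF] at h
  have e : matFun cothF (G.adDoubleHom p) = G.amDouble p := rfl
  rw [e, LinearMap.neg_apply, amDouble_inr hG hp, amDouble_inr hG hp] at h
  simpa [doublePairing_apply] using h

variable (G) in
theorem isOpenFD_amDomain : IsOpenFD 𝕜 G.amDomain := isOpenFD_avoidsPoles G.adDoubleHom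

variable (G) in
theorem zero_mem_amDomain : (0 : Module.Dual 𝕜 g) ∈ G.amDomain := by
  intro n hn hz
  have h := eval_eq_zero_of_mem_complexSpectrum hz (p := Polynomial.X) (by
    rw [Polynomial.aeval_X]; exact map_zero G.adDoubleHom)
  simp [hn, Real.pi_ne_zero] at h

variable (G) in
theorem smoothOnFD_rAM : SmoothOnFD 𝕜 G.amDomain G.rAM := by
  intro n b w
  let l : Module.End 𝕜 (g × Module.Dual 𝕜 g) →ₗ[𝕜] 𝕜 :=
    { toFun := fun X => w (LinearMap.fst 𝕜 g (Module.Dual 𝕜 g) ∘ₗ X ∘ₗ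
        LinearMap.inr 𝕜 g (Module.Dual 𝕜 g))
      map_add' := fun X Y => by rw [← map_add, LinearMap.add_comp, LinearMap.comp_add]
      map_smul' := fun a X => by
        rw [RingHom.id_apply, ← map_smul, LinearMap.smul_comp, LinearMap.comp_smul] }
  exact contDiffOn_matFun_cothF G.adDoubleHom l b

variable (G) in
theorem lineDeriv_rAM {p : Module.Dual 𝕜 g} (hp : p ∈ G.amDomain) {m q : 𝕜[X]} (hm : m ≠ 0)
    (hmp : AvoidsPoles m) (hq : JetAgree cothF (m ^ 2) q)
    (hT : Polynomial.aeval (G.adDoubleHom p) m = 0) (ξ η ζ : Module.Dual 𝕜 g) :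
    lineDeriv 𝕜 (fun q => ζ (G.rAM q η)) p ξ =
      ζ ((Polynomial.aeval (!![G.adDoubleHom p, G.adDoubleHom ξ; 0, G.adDoubleHom p] :
        Matrix (Fin 2) (Fin 2) (Module.End 𝕜 (g × Module.Dual 𝕜 g))) q 0 1) (0, η)).1 :=
  lineDeriv_matFun_cothF G.adDoubleHom
    (ζ ∘ₗ LinearMap.fst 𝕜 g (Module.Dual 𝕜 g) ∘ₗ LinearMap.applyₗ (0, η)) hp hm hmp hq hT

/-- The trilinear functional equation with all three arguments in `g*`. Since `p ↦ ad_p` is linear,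
the block corner `ad_ξ` is its derivative along `ξ`, and `⟨ζ, [ξ, η]⟩` is the value of `φ`. -/
theorem cdybe_rAM (hG : G.IsCocommutative) {p : Module.Dual 𝕜 g} (hp : p ∈ G.amDomain)
    (ξ η ζ : Module.Dual 𝕜 g) :
    (lineDeriv 𝕜 (fun q => ζ (G.rAM q η)) p ξ - ζ ⁅G.rAM p ξ, G.rAM p η⁆)
      + (lineDeriv 𝕜 (fun q => ξ (G.rAM q ζ)) p η - ξ ⁅G.rAM p η, G.rAM p ζ⁆)
      + (lineDeriv 𝕜 (fun q => η (G.rAM q ξ)) p ζ - η ⁅G.rAM p ζ, G.rAM p ξ⁆)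
      = G.φ ![ξ, η, ζ] := by
  obtain ⟨m, q, hm, hmp, -, hq, hT, hT', hF, hodd⟩ :=
    exists_odd_interpolation (T := G.adDoubleHom p) hp
  have hβ := aeval_adjoint (β := doublePairing) (T := G.adDoubleHom p) (S := -G.adDoubleHom p)
    (fun u u' v => by simp [doublePairing_apply]; ring)
    (fun a u v => by simp [doublePairing_apply]; ring)
    (fun u v => by rw [pairing_adDoubleHom hG]; simp) q
  have key := trilinear_functional_equation hm hmp hq hT hT' hodd
    (t := G.bracket) (fun u v => G.bracket_leibniz (0, p) u v) (β := doublePairing)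
    (pairing_adDoubleHom hG p) (fun u v => by rw [hβ, hodd]; simp) (pairing_cyclic hG)
    (0, ξ) (0, η) (0, ζ)
  have hFr : ∀ ξ, Polynomial.aeval (G.adDoubleHom p) q (0, ξ) = (G.rAM p ξ, 0) := fun ξ => by
    rw [← hF]; exact amDouble_inr hG hp ξ
  have hc : ∀ a b c : Module.Dual 𝕜 g, doublePairing (0, c) ((Polynomial.aeval
      (!![G.adDoubleHom p, G.bracket (0, a); 0, G.adDoubleHom p] :
        Matrix (Fin 2) (Fin 2) (Module.End 𝕜 (g × Module.Dual 𝕜 g))) q 0 1) (0, b)) =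
      lineDeriv 𝕜 (fun q => c (G.rAM q b)) p a := fun a b c => by
    rw [G.lineDeriv_rAM hp hm hmp hq hT, doublePairing_apply, map_zero, add_zero]
    rfl
  have hb : ∀ a b c : Module.Dual 𝕜 g, doublePairing (0, c) (G.bracket (G.rAM p a, 0)
      (G.rAM p b, 0)) = c ⁅G.rAM p a, G.rAM p b⁆ := fun a b c => by
    rw [bracket_apply hG, doublePairing_apply]
    simp [contract_zero_left]
  rw [hc, hc, hc, hFr, hFr, hFr, hb, hb, hb, bracket_apply hG, doublePairing_apply] at key
  simp only [zero_lie, zero_add, apply_contract, map_zero, add_zero] at key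
  rw [← key]
  ring

theorem equivariant_rAM (hG : G.IsCocommutative) {p : Module.Dual 𝕜 g} (hp : p ∈ G.amDomain)
    (z : g) (ξ η : Module.Dual 𝕜 g) :
    lineDeriv 𝕜 (fun q => η (G.rAM q ξ)) p (adStar z p)
      + η (⁅z, G.rAM p ξ⁆ + G.rAM p (adStar z ξ)) = 0 := by
  obtain ⟨m, q, hm, hmp, -, hq, hT, hT', hF, hodd⟩ :=
    exists_odd_interpolation (T := G.adDoubleHom p) hp
  -- Jacobi with `[z, p] = -ad*_z p`. The derivative of `F` along a commutator with `ad_p` is the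
  -- commutator with `F(ad_p)`.
  have hcomm : G.adDoubleHom (adStar z p) = (-G.bracket (z, 0)) * G.adDoubleHom p -
      G.adDoubleHom p * (-G.bracket (z, 0)) := by
    refine LinearMap.ext fun v => ?_
    have h := G.bracket_leibniz (z, 0) (0, p) v
    have e : G.bracket (0, -adStar z p) v = -G.bracket (0, adStar z p) v :=
      LinearMap.congr_fun (map_neg G.adDoubleHom (adStar z p)) v
    rw [bracket_inl_inr hG, e] at h
    simp only [LinearMap.sub_apply, Module.End.mul_apply, LinearMap.neg_apply, map_neg,
      adDoubleHom_apply_apply, h]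
    abel
  have hFr : ∀ ξ, Polynomial.aeval (G.adDoubleHom p) q (0, ξ) = (G.rAM p ξ, 0) := fun ξ => by
    rw [← hF]; exact amDouble_inr hG hp ξ
  rw [G.lineDeriv_rAM hp hm hmp hq hT, hcomm, aeval_block_commutator]
  simp only [LinearMap.sub_apply, Module.End.mul_apply, LinearMap.neg_apply, map_neg, hFr,
    bracket_inl_inr hG]
  rw [bracket_apply hG]
  simp only [contract_zero_left, map_zero, add_zero, Prod.fst_neg, Prod.fst_sub]
  simp only [map_neg, map_sub, map_add, neg_neg]
  ring

theorem isCoadInvariant_amDomain (hG : G.IsCocommutative) : IsCoadInvariant G.amDomain := by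
  intro z p hp
  -- The sign makes `Z` act on `g*` as `ad*_z`, so that `exp Z` carries `p` to `p ∘ e^{ad z}`. As an
  -- automorphism of the double it conjugates the two adjoint operators, which then share their
  -- characteristic polynomial.
  let Z : Module.End 𝕜 (g × Module.Dual 𝕜 g) := G.bracket (-z, 0)
  have hZ : ∀ ξ : Module.Dual 𝕜 g, Z (0, ξ) = (0, adStar z ξ) := fun ξ => by
    refine (bracket_inl_inr hG (-z) ξ).trans (Prod.ext rfl ?_)
    refine LinearMap.ext fun y => ?_
    change -ξ ⁅-z, y⁆ = ξ ⁅z, y⁆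
    rw [neg_lie, map_neg, neg_neg]
  have h1 : linExp Z (0, p) = (0, p ∘ₗ linExp (LieAlgebra.ad 𝕜 g z)) :=
    linExp_apply_of_transpose (LinearMap.inr 𝕜 g (Module.Dual 𝕜 g)) hZ p
  have h2 : ∀ v, G.adDoubleHom (p ∘ₗ linExp (LieAlgebra.ad 𝕜 g z)) (linExp Z v) =
      linExp Z (G.adDoubleHom p v) := fun v => by
    have h := linExp_apply_bilinear (fun u v => G.bracket_leibniz (-z, 0) u v) (0, p) v
    rw [adDoubleHom_apply_apply, adDoubleHom_apply_apply, ← h1]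
    exact h.symm
  let e : (g × Module.Dual 𝕜 g) ≃ₗ[𝕜] g × Module.Dual 𝕜 g :=
    LinearEquiv.ofLinearMap (linExp Z) (linExp (-Z)) (linExp_mul_linExp_neg Z)
      (linExp_neg_mul_linExp Z)
  have h4 : G.adDoubleHom (p ∘ₗ linExp (LieAlgebra.ad 𝕜 g z)) = e.conj (G.adDoubleHom p) := by
    refine LinearMap.ext fun v => ?_
    obtain ⟨u, rfl⟩ := e.surjective v
    rw [LinearEquiv.conj_apply_apply, e.symm_apply_apply]
    exact h2 u
  change AvoidsPoles (G.adDoubleHom (p ∘ₗ linExp (LieAlgebra.ad 𝕜 g z))).charpoly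
  rw [h4, LinearEquiv.charpoly_conj]
  exact hp

theorem isDynamicalRMatrix_rAM (hG : G.IsCocommutative) :
    IsDynamicalRMatrix G G.amDomain G.rAM := by
  refine ⟨hG, fun _ _ h => h, G.isOpenFD_amDomain, isCoadInvariant_amDomain hG,
    fun p hp => isSkewMap_rAM hG hp, G.smoothOnFD_rAM, fun p hp ξ η ζ => ?_, fun p hp z ξ η => ?_⟩
  · have h := cdybe_rAM hG hp ξ η ζ
    have hϖ : G.ϖ = 0 := hG
    have e : ∀ ξ : Module.Dual 𝕜 g, ξ ∘ₗ ((LieHom.id : g →ₗ⁅𝕜⁆ g) : g →ₗ[𝕜] g) = ξ := fun _ => rfl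
    simpa [hϖ, e] using h
  · have h := equivariant_rAM hG hp z ξ η
    have hϖ : G.ϖ = 0 := hG
    simpa [hϖ] using h

theorem adDouble_congr {G' : LieQuasiBialgebra 𝕜 g} (hG : G.IsCocommutative)
    (hG' : G'.IsCocommutative) (h : G'.φ = G.φ) : G'.adDouble = G.adDouble := by
  funext p
  rw [adDouble, adDouble, hG, hG', h]

theorem amDomain_congr {G' : LieQuasiBialgebra 𝕜 g} (hG : G.IsCocommutative)
    (hG' : G'.IsCocommutative) (h : G'.φ = G.φ) : G'.amDomain = G.amDomain := by
  rw [amDomain, amDomain, adDouble_congr hG hG' h]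

theorem rAM_congr {G' : LieQuasiBialgebra 𝕜 g} (hG : G.IsCocommutative)
    (hG' : G'.IsCocommutative) (h : G'.φ = G.φ) (p : Module.Dual 𝕜 g) : G'.rAM p = G.rAM p := by
  rw [rAM, rAM, amDouble, amDouble, adDouble_congr hG hG' h]

section Invariant

variable {Ω : Module.Dual 𝕜 g →ₗ[𝕜] g}

/-- An invariant map with the given associator intertwines `ad^𝔡_p` and `ad_{Ω p}`. -/
theorem coprod_adDoubleHom (hG : G.IsCocommutative)
    (hinv : ∀ (x : g) (ξ : Module.Dual 𝕜 g), ⁅x, Ω ξ⁆ + Ω (adStar x ξ) = 0)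
    (hφ : ∀ ξ η ζ : Module.Dual 𝕜 g, G.φ ![ξ, η, ζ] = ζ ⁅Ω ξ, Ω η⁆)
    (p : Module.Dual 𝕜 g) (v : g × Module.Dual 𝕜 g) :
    LinearMap.coprod LinearMap.id Ω (G.adDoubleHom p v) =
      LieAlgebra.ad 𝕜 g (Ω p) (LinearMap.coprod LinearMap.id Ω v) := by
  have hc : contract G.φ p v.2 = ⁅Ω p, Ω v.2⁆ := ext_dual (𝕜 := 𝕜) fun ζ => by
    rw [apply_contract, hφ]
  rw [adDoubleHom_apply_apply, bracket_apply hG]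
  simp only [LinearMap.coprod_apply, LinearMap.id_apply, zero_lie, adStar_zero,
    LinearMap.zero_apply, neg_zero, zero_add, hc, LieAlgebra.ad_apply, lie_add]
  rw [eq_neg_of_add_eq_zero_right (hinv v.1 p), lie_skew, add_comm]

/-- The intertwiner `(x, ξ) ↦ x + Ω ξ` is the identity on `g`, hence onto. The characteristic
polynomial of `ad_p` on the double thus kills `ad_{Ω p}`, whose eigenvalues are among its roots. -/
theorem avoidsPoles_ad (hG : G.IsCocommutative)
    (hinv : ∀ (x : g) (ξ : Module.Dual 𝕜 g), ⁅x, Ω ξ⁆ + Ω (adStar x ξ) = 0)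
    (hφ : ∀ ξ η ζ : Module.Dual 𝕜 g, G.φ ![ξ, η, ζ] = ζ ⁅Ω ξ, Ω η⁆)
    {p : Module.Dual 𝕜 g} (hp : p ∈ G.amDomain) :
    AvoidsPoles (LieAlgebra.ad 𝕜 g (Ω p) : Module.End 𝕜 g).charpoly := by
  intro n hn hz
  refine hp n hn (eval_eq_zero_of_mem_complexSpectrum (T := LieAlgebra.ad 𝕜 g (Ω p)) hz
    (p := (G.adDoubleHom p).charpoly) ?_)
  refine LinearMap.ext fun x => ?_
  have h := aeval_intertwine (coprod_adDoubleHom hG hinv hφ p) (G.adDoubleHom p).charpoly (x, 0)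
  rw [LinearMap.aeval_self_charpoly] at h
  simpa using h.symm

theorem rAM_eq_matFun_ad (hG : G.IsCocommutative)
    (hinv : ∀ (x : g) (ξ : Module.Dual 𝕜 g), ⁅x, Ω ξ⁆ + Ω (adStar x ξ) = 0)
    (hφ : ∀ ξ η ζ : Module.Dual 𝕜 g, G.φ ![ξ, η, ζ] = ζ ⁅Ω ξ, Ω η⁆)
    {p : Module.Dual 𝕜 g} (hp : p ∈ G.amDomain) :
    G.rAM p = matFun cothF (LieAlgebra.ad 𝕜 g (Ω p)) ∘ₗ Ω := by
  let S : Module.End 𝕜 g := LieAlgebra.ad 𝕜 g (Ω p)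
  -- Modulo the product of the two characteristic polynomials, a single `q` computes `F` of both
  -- operators.
  have hm : (G.adDoubleHom p).charpoly * S.charpoly ≠ 0 :=
    mul_ne_zero (LinearMap.charpoly_monic _).ne_zero (LinearMap.charpoly_monic _).ne_zero
  have hmp : AvoidsPoles ((G.adDoubleHom p).charpoly * S.charpoly) :=
    AvoidsPoles.mul hp (avoidsPoles_ad hG hinv hφ hp)
  obtain ⟨-, -, q, -, -, -, hq⟩ := exists_jetAgree_cothF hm hmp
  have h1 : G.amDouble p = Polynomial.aeval (G.adDoubleHom p) q :=
    matFun_eq_aeval (hq.interpolates hm (dvd_mul_right _ _))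
  have h2 : matFun cothF S = Polynomial.aeval S q :=
    matFun_eq_aeval (hq.interpolates hm (dvd_mul_left _ _))
  refine LinearMap.ext fun ξ => ?_
  have h := aeval_intertwine (coprod_adDoubleHom hG hinv hφ p) q (0, ξ)
  rw [← h1, amDouble_inr hG hp] at h
  rw [LinearMap.comp_apply]
  change _ = matFun cothF S (Ω ξ)
  rw [h2]
  simpa using h

end Invariant

end LieQuasiBialgebra

end

theorem mainTheorem8 {𝕜 : Type*} [RCLike 𝕜] {g : Type*} [LieRing g] [LieAlgebra 𝕜 g]
    [FiniteDimensional 𝕜 g] (G : LieQuasiBialgebra 𝕜 g) (hG : G.IsCocommutative) :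
    -- the domain is an open coadjoint-invariant neighbourhood of `0`
    (IsOpenFD 𝕜 G.amDomain ∧ IsCoadInvariant G.amDomain ∧ (0 : Module.Dual 𝕜 g) ∈ G.amDomain) ∧
    -- on it `F(ad_p)` exists and maps `g*` to `g`
    (∀ p ∈ G.amDomain, (∃ q : Polynomial 𝕜, Interpolates cothF (G.adDouble p) q) ∧
      ∀ ξ : Module.Dual 𝕜 g, G.amDouble p (0, ξ) = (G.rAM p ξ, 0)) ∧
    -- it is a dynamical `r`-matrix
    IsDynamicalRMatrix G G.amDomain G.rAM ∧
    -- it only depends on the associator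
    (∀ G' : LieQuasiBialgebra 𝕜 g, G'.IsCocommutative → G'.φ = G.φ →
      G'.amDomain = G.amDomain ∧ ∀ p ∈ G.amDomain, G'.rAM p = G.rAM p) ∧
    -- in particular it is `F(ad_{Ω p}) Ω` for every invariant symmetric `Ω` with this associator
    (∀ Ω : Module.Dual 𝕜 g →ₗ[𝕜] g,
      (∀ ξ η : Module.Dual 𝕜 g, η (Ω ξ) = ξ (Ω η)) →
      (∀ (x : g) (ξ : Module.Dual 𝕜 g), ⁅x, Ω ξ⁆ + Ω (adStar x ξ) = 0) →
      (∀ ξ η ζ : Module.Dual 𝕜 g, G.φ ![ξ, η, ζ] = ζ ⁅Ω ξ, Ω η⁆) →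
      ∀ p ∈ G.amDomain, (∃ q : Polynomial 𝕜, Interpolates cothF (LieAlgebra.ad 𝕜 g (Ω p)) q) ∧
        G.rAM p = matFun cothF (LieAlgebra.ad 𝕜 g (Ω p)) ∘ₗ Ω) :=
  ⟨⟨G.isOpenFD_amDomain, LieQuasiBialgebra.isCoadInvariant_amDomain hG, G.zero_mem_amDomain⟩,
    fun _ hp => ⟨exists_interpolates_cothF (T := G.adDoubleHom _) hp, fun ξ => LieQuasiBialgebra.amDouble_inr hG hp ξ⟩,
    LieQuasiBialgebra.isDynamicalRMatrix_rAM hG,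
    fun _ hG' h => ⟨LieQuasiBialgebra.amDomain_congr hG hG' h,
      fun p _ => LieQuasiBialgebra.rAM_congr hG hG' h p⟩,
    fun _ _ hinv hφ _ hp =>
      ⟨exists_interpolates_cothF (LieQuasiBialgebra.avoidsPoles_ad hG hinv hφ hp),
        LieQuasiBialgebra.rAM_eq_matFun_ad hG hinv hφ hp⟩⟩
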